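/- \textbf{Definitions.} A \emph{graph} is a finite set $V$ of vertices and a finite set $H$ of half-edges with a map $r:H\to V$ (incident vertex) and a fixed-point free involution $s:H\to H$; its edges are the $s$-orbits, so loops and parallel edges are allowed. Fix an integer $g\ge 2$. A \emph{stable graph of genus $g$} is a connected (in particular nonempty) graph with vertex weights $w:V\to\mathbb{Z}_{\ge 0}$ such that $(|E|-|V|+1)+\sum_{v\in V}w(v)=g$ and $2w(v)-2+\operatorname{val}(v)>0$ for all $v\in V$, where $\operatorname{val}(v)=|r^{-1}(v)|$. Contracting a loop removes it and raises the weight of its vertex by $1$; contracting a nonloop edge removes it and merges its two ends into one vertex whose weight is the sum of their weights. For $p\ge -1$ put $[p]=\{0,\dots,p\}$ (so $[-1]=\varnothing$), and let $\mathrm{I}$ be the category whose objects are the sets $[p]$, $p\ge -1$, and whose morphisms are the injections. A \emph{symmetric $\Delta$-complex} is a functor $\mathrm{I}^{\mathrm{op}}\to\mathsf{Set}$; morphisms are natural transformations, and a subcomplex is a subfunctor. The symmetric $\Delta$-complex $\Delta_g$ sends $[p]$ to the set of isomorphism classes $[\mathbf{G},\tau]$ of stable graphs $\mathbf{G}$ of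 genus $g$ with a bijective edge-labelling $\tau:E(\mathbf{G})\to[p]$. An injection $\iota:[p]\to[q]$ sends $[\mathbf{G},\tau]\in\Delta_g[q]$ to the class obtained by contracting all edges whose label is not in $\iota([p])$ and giving the edge with label $\iota(i)$ the new label $i$. Let $\mathsf{V}^2_g\subseteq\Delta_g$ be the subcomplex of all $[\mathbf{G},\tau]$ such that $\mathbf{G}$ has at most two vertices. \textbf{Corollary.} Let $g\ge 2$. Then every automorphism $\Phi\in\operatorname{Aut}(\Delta_g)$ of the symmetric $\Delta$-complex $\Delta_g$ satisfies \[\Phi|_{\mathsf{V}^2_g}=\mathrm{Id}|_{\mathsf{V}^2_g},\] and the group $\operatorname{Aut}(\Delta_g)$ is trivial. -/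

import Mathlib

open CategoryTheory

noncomputable section

namespace TropicalModuli

/-! ### Graphs -/

/-- A finite graph given by vertices and half-edges: `r` sends a half-edge to its incident
vertex, and `s` is the fixed-point free involution that couples the two halves of an edge.
(On the set `X = V ⊔ H` both maps are extended by the identity on `V`.)
Loops and parallel edges are allowed. -/
structure HalfEdgeGraph : Type 1 where
  V : Type
  H : Type
  [fintypeV : Fintype V]
  [fintypeH : Fintype H]
  r : H → V
  s : H → H
  s_s : ∀ h, s (s h) = h
  s_ne : ∀ h, s h ≠ h

attribute [instance] HalfEdgeGraph.fintypeV HalfEdgeGraph.fintypeH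

namespace HalfEdgeGraph

variable (G : HalfEdgeGraph)

/-- Two half-edges are equivalent when they are equal or coupled by `s`. -/
def edgeSetoid : Setoid G.H where
  r h k := k = h ∨ k = G.s h
  iseqv := by
    refine ⟨fun h => Or.inl rfl, ?_, ?_⟩
    · rintro h k (rfl | rfl)
      · exact Or.inl rfl
      · exact Or.inr (G.s_s h).symm
    · rintro h k l (rfl | rfl) (rfl | rfl)
      · exact Or.inl rfl
      · exact Or.inr rfl
      · exact Or.inr rfl
      · exact Or.inl (G.s_s h)

/-- The set of edges, the quotient of the set of half-edges by `s`. -/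
def Edge : Type := Quotient G.edgeSetoid

instance : Finite G.Edge := inferInstanceAs (Finite (Quotient G.edgeSetoid))

instance : Fintype G.Edge := Fintype.ofFinite _

/-- The edge containing a half-edge. -/
def edge (h : G.H) : G.Edge := Quotient.mk G.edgeSetoid h

/-- `u` and `v` are the two endpoints of an edge in the set `S`. -/
def Link (S : Set G.Edge) (u v : G.V) : Prop :=
  ∃ h : G.H, G.edge h ∈ S ∧ G.r h = u ∧ G.r (G.s h) = v

/-- The graph is nonempty and any two vertices are joined by a path of edges. -/
def Connected : Prop :=
  Nonempty G.V ∧ ∀ u v : G.V, Relation.ReflTransGen (G.Link Set.univ) u v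

/-- The first Betti number `|E| - |V| + 1` of a connected graph. -/
def b1 : ℤ := (Fintype.card G.Edge : ℤ) - Fintype.card G.V + 1

open Classical in
/-- The valence of a vertex: the number of half-edges incident to it. -/
def val (v : G.V) : ℕ := (Finset.univ.filter fun h : G.H => G.r h = v).card

variable {G}

theorem edge_eq_iff {h k : G.H} : G.edge h = G.edge k ↔ k = h ∨ k = G.s h :=
  Quotient.eq (r := G.edgeSetoid)

@[simp] theorem edge_s (h : G.H) : G.edge (G.s h) = G.edge h :=
  edge_eq_iff.2 (Or.inr (G.s_s h).symm)

theorem edge_surjective : Function.Surjective G.edge := Quotient.mk_surjective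

end HalfEdgeGraph

/-- A stable weighted graph of genus `g`: a connected graph with vertex weights such that
`b1 + ∑ w = g` and `2 w(v) - 2 + val(v) > 0` at every vertex. -/
structure StableGraph (g : ℕ) : Type 1 extends HalfEdgeGraph where
  w : V → ℕ
  connected : toHalfEdgeGraph.Connected
  genus_eq : toHalfEdgeGraph.b1 + ∑ v, (w v : ℤ) = g
  stable : ∀ v, 2 < 2 * w v + toHalfEdgeGraph.val v

/-! ### Contraction of a set of edges -/

namespace HalfEdgeGraph

variable (G : HalfEdgeGraph) (S : Set G.Edge)

/-- The graph obtained by contracting all edges in `S`: the vertices are the connected components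
of the subgraph with vertex set `V` and edge set `S`, the half-edges are those not in `S`. -/
def contract : HalfEdgeGraph where
  V := Quot (G.Link S)
  H := {h : G.H // G.edge h ∉ S}
  fintypeV := Fintype.ofFinite _
  fintypeH := Fintype.ofFinite _
  r h := Quot.mk _ (G.r h.1)
  s h := ⟨G.s h.1, by simpa using h.2⟩
  s_s h := Subtype.ext (G.s_s h.1)
  s_ne h e := G.s_ne h.1 (congrArg Subtype.val e)

/-- The vertex of the contracted graph to which a vertex is sent. -/
def toContract (v : G.V) : (G.contract S).V := Quot.mk _ v

open Classical in
/-- The vertices that are collapsed to `c`. -/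
def vertsOver (c : (G.contract S).V) : Finset G.V :=
  Finset.univ.filter fun v => G.toContract S v = c

open Classical in
/-- The contracted edges that are collapsed to `c`. -/
def edgesOver (c : (G.contract S).V) : Finset G.Edge :=
  Finset.univ.filter fun e => e ∈ S ∧ ∃ h, G.edge h = e ∧ G.toContract S (G.r h) = c

/-- The weight of the vertex `c` after the contraction of `S`: the total weight of the connected
subgraph collapsed to `c` plus its first Betti number (`|E| + 1 - |V|`; no truncation occurs, see
`card_vertsOver_le`). For a single loop this adds `1` to the weight of its vertex, for a single
nonloop edge it adds the weights of its two ends. -/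
def contractWeight (w : G.V → ℕ) (c : (G.contract S).V) : ℕ :=
  ∑ v ∈ G.vertsOver S c, w v + ((G.edgesOver S c).card + 1 - (G.vertsOver S c).card)

variable {G S}

theorem toContract_s {h : G.H} (hh : G.edge h ∈ S) :
    G.toContract S (G.r (G.s h)) = G.toContract S (G.r h) :=
  (Quot.sound ⟨h, hh, rfl, rfl⟩ : Quot.mk (G.Link S) (G.r h) = Quot.mk _ (G.r (G.s h))).symm

theorem mem_edgesOver {h : G.H} {c : (G.contract S).V} :
    G.edge h ∈ G.edgesOver S c ↔ G.edge h ∈ S ∧ G.toContract S (G.r h) = c := by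
  classical
  simp only [edgesOver, Finset.mem_filter, Finset.mem_univ, true_and]
  refine and_congr_right fun hS => ⟨?_, fun e => ⟨h, rfl, e⟩⟩
  rintro ⟨k, hk, e⟩
  rcases edge_eq_iff.1 hk with rfl | rfl
  · exact e
  · rw [toContract_s (by rwa [edge_s] at hS)]; exact e

theorem mem_vertsOver {v : G.V} {c : (G.contract S).V} :
    v ∈ G.vertsOver S c ↔ G.toContract S v = c := by
  classical
  simp [vertsOver]

theorem card_vertsOver_le (c : (G.contract S).V) :
    (G.vertsOver S c).card ≤ (G.edgesOver S c).card + 1 := by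
  classical
  let A := {v : G.V // v ∈ G.vertsOver S c}
  let K : SimpleGraph A := SimpleGraph.fromRel fun a b => G.Link S a.1 b.1
  have hreach : ∀ u v : G.V, Relation.EqvGen (G.Link S) u v →
      ∀ (hu : u ∈ G.vertsOver S c) (hv : v ∈ G.vertsOver S c), K.Reachable ⟨u, hu⟩ ⟨v, hv⟩ := by
    intro u v huv
    induction huv with
    | rel u v h =>
      intro hu hv
      by_cases e : u = v
      · subst e; exact SimpleGraph.Reachable.refl _
      · exact SimpleGraph.Adj.reachable
          ((SimpleGraph.fromRel_adj _ _ _).2 ⟨fun e' => e (congrArg Subtype.val e'), Or.inl h⟩)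
    | refl u => intro hu hv; exact SimpleGraph.Reachable.refl _
    | symm u v _ ih => intro hu hv; exact (ih hv hu).symm
    | trans u v x h1 _ ih1 ih2 =>
      intro hu hx
      have hv : v ∈ G.vertsOver S c := by
        rw [mem_vertsOver] at hu ⊢
        rw [← hu]; exact (Quot.eqvGen_sound h1).symm
      exact (ih1 hu hv).trans (ih2 hv hx)
  have hconn : K.Connected := by
    rw [SimpleGraph.connected_iff]
    refine ⟨fun a b => hreach a.1 b.1 (Quot.eqvGen_exact ?_) a.2 b.2, ?_⟩
    · exact (mem_vertsOver.1 a.2).trans (mem_vertsOver.1 b.2).symm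
    · obtain ⟨v, rfl⟩ := Quot.exists_rep c
      exact ⟨⟨v, mem_vertsOver.2 rfl⟩⟩
  have h1 := hconn.card_vert_le_card_edgeSet_add_one
  have hex : ∀ x : K.edgeSet, ∃ h : G.H, G.edge h ∈ G.edgesOver S c ∧
      Sym2.map Subtype.val x.1 = s(G.r h, G.r (G.s h)) := by
    rintro ⟨x, hx⟩
    induction x using Sym2.ind with
    | _ a b =>
      rw [SimpleGraph.mem_edgeSet, SimpleGraph.fromRel_adj] at hx
      rcases hx.2 with ⟨h, hS, ha, hb⟩ | ⟨h, hS, ha, hb⟩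
      · exact ⟨h, mem_edgesOver.2 ⟨hS, by rw [ha]; exact mem_vertsOver.1 a.2⟩, by simp [ha, hb]⟩
      · refine ⟨h, mem_edgesOver.2 ⟨hS, by rw [ha]; exact mem_vertsOver.1 b.2⟩, ?_⟩
        simp [ha, hb, Sym2.eq_swap]
  choose f hf1 hf2 using hex
  have hinj : Function.Injective
      (fun x : K.edgeSet => (⟨G.edge (f x), hf1 x⟩ : {e // e ∈ G.edgesOver S c})) := by
    intro x y hxy
    have hxy' : G.edge (f x) = G.edge (f y) := congrArg Subtype.val hxy
    apply Subtype.ext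
    apply Sym2.map.injective Subtype.val_injective
    rw [hf2, hf2]
    rcases edge_eq_iff.1 hxy' with e | e
    · rw [e]
    · rw [e, G.s_s, Sym2.eq_swap]
  have h2 := Nat.card_le_card_of_injective _ hinj
  have h2' : Nat.card {e // e ∈ G.edgesOver S c} = (G.edgesOver S c).card := by
    simp [Nat.card_eq_fintype_card]
  have h3 : Nat.card A = (G.vertsOver S c).card := by
    simp [A, Nat.card_eq_fintype_card]
  omega

theorem contractWeight_cast (w : G.V → ℕ) (c : (G.contract S).V) :
    (G.contractWeight S w c : ℤ) = ∑ v ∈ G.vertsOver S c, (w v : ℤ) +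
      ((G.edgesOver S c).card - (G.vertsOver S c).card + 1) := by
  have := card_vertsOver_le c
  unfold contractWeight
  push_cast [Nat.cast_sub this]
  ring

open Classical in
/-- Every edge consists of two half-edges. -/
theorem card_halfEdges (T : Finset G.Edge) :
    (Finset.univ.filter fun h : G.H => G.edge h ∈ T).card = 2 * T.card := by
  rw [Finset.card_eq_sum_card_fiberwise (f := G.edge) (t := T) (fun h hh => by simpa using hh),
    Finset.sum_const_nat (m := 2), mul_comm]
  intro e he
  obtain ⟨h, rfl⟩ := edge_surjective e
  rw [Finset.card_eq_two]
  refine ⟨h, G.s h, (G.s_ne h).symm, ?_⟩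
  ext k
  simp only [Finset.mem_filter, Finset.mem_univ, true_and, Finset.mem_insert,
    Finset.mem_singleton]
  constructor
  · rintro ⟨_, hk⟩
    exact edge_eq_iff.1 hk.symm
  · rintro (rfl | rfl)
    · exact ⟨he, rfl⟩
    · exact ⟨by rwa [edge_s], edge_s h⟩

theorem contract_connected (hG : G.Connected) : (G.contract S).Connected := by
  obtain ⟨⟨v⟩, h⟩ := hG
  refine ⟨⟨G.toContract S v⟩, ?_⟩
  intro a b
  obtain ⟨u, rfl⟩ := Quot.exists_rep a
  obtain ⟨v, rfl⟩ := Quot.exists_rep b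
  have key := h u v
  induction key with
  | refl => exact Relation.ReflTransGen.refl
  | tail _ hl ih =>
    obtain ⟨k, -, rfl, rfl⟩ := hl
    by_cases hk : G.edge k ∈ S
    · have e := toContract_s hk
      unfold toContract at e
      rw [e]; exact ih
    · exact ih.tail ⟨⟨k, hk⟩, Set.mem_univ _, rfl, rfl⟩

/-- The edges of the contracted graph are the edges that are not contracted. -/
def contractEdgeEquiv (G : HalfEdgeGraph) (S : Set G.Edge) :
    (G.contract S).Edge ≃ {e : G.Edge // e ∉ S} :=
  Equiv.ofBijective
    (Quotient.lift (s := (G.contract S).edgeSetoid)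
      (fun h : {h : G.H // G.edge h ∉ S} => (⟨G.edge h.1, h.2⟩ : {e : G.Edge // e ∉ S}))
      (by
        rintro h k (rfl | rfl)
        · rfl
        · exact Subtype.ext (edge_s h.1).symm))
    (by
      constructor
      · intro a b
        obtain ⟨h, rfl⟩ := edge_surjective a
        obtain ⟨k, rfl⟩ := edge_surjective b
        intro e
        have e' : G.edge h.1 = G.edge k.1 := congrArg Subtype.val e
        apply edge_eq_iff.2
        rcases edge_eq_iff.1 e' with e'' | e''
        · exact Or.inl (Subtype.ext e'')
        · exact Or.inr (Subtype.ext e'')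
      · rintro ⟨e, he⟩
        obtain ⟨h, rfl⟩ := edge_surjective e
        exact ⟨(G.contract S).edge ⟨h, he⟩, rfl⟩)

@[simp] theorem contractEdgeEquiv_edge (h : (G.contract S).H) :
    (contractEdgeEquiv G S ((G.contract S).edge h) : G.Edge) = G.edge h.1 := rfl

end HalfEdgeGraph

open HalfEdgeGraph in
open Classical in
/-- The stable graph obtained by contracting all edges in `S`. -/
def StableGraph.contract {g : ℕ} (G : StableGraph g) (S : Set G.Edge) : StableGraph g where
  toHalfEdgeGraph := G.toHalfEdgeGraph.contract S
  w := G.toHalfEdgeGraph.contractWeight S G.w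
  connected := contract_connected G.connected
  genus_eq := by
    have hg := G.genus_eq
    have hv : ∑ c, ((G.vertsOver S c).card : ℤ) = Fintype.card G.V := by
      have := Finset.card_eq_sum_card_fiberwise (s := (Finset.univ : Finset G.V))
        (f := G.toContract S) (t := Finset.univ) (fun _ _ => Finset.mem_coe.2 (Finset.mem_univ _))
      rw [Finset.card_univ] at this
      rw [this]; push_cast; rfl
    have hw : ∑ c, ∑ v ∈ G.vertsOver S c, (G.w v : ℤ) = ∑ v, (G.w v : ℤ) :=
      Finset.sum_fiberwise_of_maps_to (t := Finset.univ) (g := G.toContract S)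
        (fun _ _ => Finset.mem_univ _) _
    have he : ∑ c, (G.edgesOver S c).card =
        (Finset.univ.filter fun e : G.Edge => e ∈ S).card := by
      rw [← Finset.card_biUnion]
      · congr 1
        ext e
        obtain ⟨h, rfl⟩ := edge_surjective e
        simp only [Finset.mem_biUnion, Finset.mem_univ, true_and, mem_edgesOver,
          Finset.mem_filter]
        exact ⟨fun ⟨_, h, _⟩ => h, fun h => ⟨_, h, rfl⟩⟩
      · intro c _ d _ hcd
        rw [Function.onFun, Finset.disjoint_left]
        intro e
        obtain ⟨h, rfl⟩ := edge_surjective e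
        rw [mem_edgesOver, mem_edgesOver]
        rintro ⟨_, h1⟩ ⟨_, h2⟩
        exact hcd (h1.symm.trans h2)
    have hE : Fintype.card (G.toHalfEdgeGraph.contract S).Edge +
        (Finset.univ.filter fun e : G.Edge => e ∈ S).card = Fintype.card G.Edge := by
      rw [Fintype.card_congr (contractEdgeEquiv _ _), Fintype.card_subtype, add_comm,
        Finset.card_filter_add_card_filter_not, Finset.card_univ]
    have he' : ∑ c, ((G.edgesOver S c).card : ℤ) =
        (Finset.univ.filter fun e : G.Edge => e ∈ S).card := by exact_mod_cast he
    have hE' : (Fintype.card (G.toHalfEdgeGraph.contract S).Edge : ℤ) +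
        (Finset.univ.filter fun e : G.Edge => e ∈ S).card = Fintype.card G.Edge := by
      exact_mod_cast hE
    simp only [contractWeight_cast, Finset.sum_add_distrib, Finset.sum_sub_distrib, hw, hv, he',
      Finset.sum_const, Finset.card_univ, nsmul_eq_mul, mul_one]
    unfold b1 at hg ⊢
    linarith
  stable c := by
    have h1 : ∑ h ∈ G.vertsOver S c, G.val h =
        (Finset.univ.filter fun h : G.H => G.toContract S (G.r h) = c).card := by
      rw [Finset.card_eq_sum_card_fiberwise (f := G.r) (t := G.vertsOver S c)
        (fun h hh => by simpa [mem_vertsOver] using hh)]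
      refine Finset.sum_congr rfl fun v hv => ?_
      unfold HalfEdgeGraph.val
      congr 1
      ext h
      simp only [Finset.mem_filter, Finset.mem_univ, true_and]
      exact ⟨fun e => ⟨by rw [e]; exact mem_vertsOver.1 hv, e⟩, fun e => e.2⟩
    have h2 : (Finset.univ.filter fun h : G.H => G.toContract S (G.r h) = c).card =
        2 * (G.edgesOver S c).card + (G.toHalfEdgeGraph.contract S).val c := by
      rw [← card_halfEdges, ← Finset.card_filter_add_card_filter_not
        (fun h : G.H => G.edge h ∈ S)]
      congr 1
      · congr 1
        ext h
        simp [mem_edgesOver, and_comm]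
      · unfold HalfEdgeGraph.val
        symm
        apply Finset.card_bij (fun (h : (G.toHalfEdgeGraph.contract S).H) _ => h.1)
        · intro h hh
          simp only [Finset.mem_filter, Finset.mem_univ, true_and] at hh ⊢
          exact ⟨hh, h.2⟩
        · intro a _ b _ e
          exact Subtype.ext e
        · intro h hh
          simp only [Finset.mem_filter, Finset.mem_univ, true_and] at hh
          exact ⟨⟨h, hh.2⟩, Finset.mem_filter.2 ⟨Finset.mem_univ _, hh.1⟩, rfl⟩
    have h3 : (G.vertsOver S c).card * 3 ≤ ∑ v ∈ G.vertsOver S c, (2 * G.w v + G.val v) :=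
      Finset.card_nsmul_le_sum _ _ 3 fun v _ => G.stable v
    rw [Finset.sum_add_distrib, ← Finset.mul_sum] at h3
    have h4 : 0 < (G.vertsOver S c).card := by
      obtain ⟨v, rfl⟩ := Quot.exists_rep c
      exact Finset.card_pos.2 ⟨v, mem_vertsOver.2 rfl⟩
    have h5 := card_vertsOver_le (G := G.toHalfEdgeGraph) c
    unfold contractWeight
    omega

/-! ### Edge-labelled pairs -/

/-- A stable weighted graph of genus `g` with `k` edges, together with a bijective labelling of its
edges by `{0, …, k - 1}`. -/
structure LabelledPair (g k : ℕ) : Type 1 extends StableGraph g where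
  τ : toHalfEdgeGraph.Edge ≃ Fin k

/-- An isomorphism of edge-labelled pairs: bijections on vertices and half-edges compatible with
`r`, `s`, the weights and the edge-labellings. -/
structure LabelledPair.Iso {g k : ℕ} (P Q : LabelledPair g k) where
  onV : P.V ≃ Q.V
  onH : P.H ≃ Q.H
  map_r : ∀ h, Q.r (onH h) = onV (P.r h)
  map_s : ∀ h, Q.s (onH h) = onH (P.s h)
  map_w : ∀ v, Q.w (onV v) = P.w v
  map_τ : ∀ h, Q.τ (Q.edge (onH h)) = P.τ (P.edge h)

namespace LabelledPair

variable {g k l m : ℕ}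

/-- Isomorphism of edge-labelled pairs as an equivalence relation. -/
instance setoid (g k : ℕ) : Setoid (LabelledPair g k) where
  r P Q := Nonempty (P.Iso Q)
  iseqv :=
    { refl := fun P => ⟨⟨Equiv.refl _, Equiv.refl _, fun _ => rfl, fun _ => rfl, fun _ => rfl,
        fun _ => rfl⟩⟩
      symm := by
        rintro P Q ⟨φ⟩
        refine ⟨⟨φ.onV.symm, φ.onH.symm, fun h => ?_, fun h => ?_, fun v => ?_, fun h => ?_⟩⟩
        · rw [Equiv.eq_symm_apply, ← φ.map_r, Equiv.apply_symm_apply]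
        · rw [Equiv.eq_symm_apply, ← φ.map_s, Equiv.apply_symm_apply]
        · rw [← φ.map_w, Equiv.apply_symm_apply]
        · rw [← φ.map_τ, Equiv.apply_symm_apply]
      trans := by
        rintro P Q R ⟨φ⟩ ⟨ψ⟩
        refine ⟨⟨φ.onV.trans ψ.onV, φ.onH.trans ψ.onH, fun h => ?_, fun h => ?_, fun v => ?_,
          fun h => ?_⟩⟩
        · simp [φ.map_r, ψ.map_r]
        · simp [φ.map_s, ψ.map_s]
        · simp [φ.map_w, ψ.map_w]
        · simp [φ.map_τ, ψ.map_τ] }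

/-- The edges whose labels are not in the image of `ι`. -/
def offImage (ι : Fin k ↪ Fin l) (P : LabelledPair g l) : Set P.Edge :=
  {e | P.τ e ∉ Set.range ι}

/-- The face of an edge-labelled pair along an injection `ι`: contract all edges whose label is not
in the image of `ι` and label the remaining edges so that the edge labelled `ι i` gets the label
`i`. -/
def face (ι : Fin k ↪ Fin l) (P : LabelledPair g l) : LabelledPair g k where
  toStableGraph := P.toStableGraph.contract (P.offImage ι)
  τ := (HalfEdgeGraph.contractEdgeEquiv P.toHalfEdgeGraph (P.offImage ι)).trans
    ((P.τ.subtypeEquiv fun _ => not_not).trans (Equiv.ofInjective ι ι.injective).symm)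

/-- The label of a half-edge. -/
def lab (P : LabelledPair g k) (h : P.H) : Fin k := P.τ (P.edge h)

theorem lab_eq_iff {P : LabelledPair g k} {h h' : P.H} :
    P.lab h = P.lab h' ↔ h' = h ∨ h' = P.s h := by
  unfold lab
  rw [P.τ.injective.eq_iff, HalfEdgeGraph.edge_eq_iff]

theorem lab_surjective (P : LabelledPair g k) : Function.Surjective P.lab :=
  P.τ.surjective.comp HalfEdgeGraph.edge_surjective

@[simp] theorem lab_s (P : LabelledPair g k) (h : P.H) : P.lab (P.s h) = P.lab h := by
  simp [lab]

open Classical in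
/-- Auxiliary characterization, used for the functoriality of faces only: `(f, j)` exhibits `Q` as
the face of `P` along `ι`. -/
structure IsFace (ι : Fin k ↪ Fin l) (P : LabelledPair g l) (Q : LabelledPair g k)
    (f : P.V → Q.V) (j : Q.H → P.H) : Prop where
  surj : Function.Surjective f
  lab_j : ∀ h, P.lab (j h) = ι (Q.lab h)
  s_j : ∀ h, P.s (j h) = j (Q.s h)
  r_j : ∀ h, f (P.r (j h)) = Q.r h
  ker : ∀ u v, f u = f v ↔
    Relation.EqvGen (fun a b => ∃ h, P.lab h ∉ Set.range ι ∧ P.r h = a ∧ P.r (P.s h) = b) u v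
  weight : ∀ c, (Q.w c : ℤ) = ∑ v with f v = c, (P.w v : ℤ) +
    ((Finset.univ.filter fun i : Fin l => i ∉ Set.range ι ∧ ∃ h, P.lab h = i ∧ f (P.r h) = c).card
      - (Finset.univ.filter fun v => f v = c).card + 1)

namespace IsFace

variable {ι : Fin k ↪ Fin l} {P : LabelledPair g l} {Q Q' : LabelledPair g k}
  {f : P.V → Q.V} {j : Q.H → P.H}

theorem inj (F : IsFace ι P Q f j) : Function.Injective j := by
  intro a b e
  have h1 : Q.lab a = Q.lab b := ι.injective (by rw [← F.lab_j, ← F.lab_j, e])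
  rcases lab_eq_iff.1 h1 with h | h
  · exact h.symm
  · exfalso
    rw [h, ← F.s_j] at e
    exact P.s_ne _ e.symm

theorem range_j (F : IsFace ι P Q f j) (h : P.H) :
    h ∈ Set.range j ↔ P.lab h ∈ Set.range ι := by
  constructor
  · rintro ⟨a, rfl⟩
    exact ⟨_, (F.lab_j a).symm⟩
  · rintro ⟨i, hi⟩
    obtain ⟨a, rfl⟩ := Q.lab_surjective i
    rw [← F.lab_j] at hi
    rcases lab_eq_iff.1 hi with e | e
    · exact ⟨a, e.symm⟩
    · exact ⟨Q.s a, by rw [e, F.s_j]⟩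

theorem f_s (F : IsFace ι P Q f j) {h : P.H} (hh : P.lab h ∉ Set.range ι) :
    f (P.r (P.s h)) = f (P.r h) :=
  ((F.ker _ _).2 (Relation.EqvGen.rel _ _ ⟨h, hh, rfl, rfl⟩)).symm

theorem exists_lab_iff (F : IsFace ι P Q f j) {h : P.H} (hh : P.lab h ∉ Set.range ι) (c : Q.V) :
    (∃ h', P.lab h' = P.lab h ∧ f (P.r h') = c) ↔ f (P.r h) = c := by
  constructor
  · rintro ⟨h', e, rfl⟩
    rcases lab_eq_iff.1 e with rfl | rfl
    · rfl
    · rw [F.f_s (by rwa [lab_s] at hh)]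
  · exact fun e => ⟨h, rfl, e⟩

theorem unique {f' : P.V → Q'.V} {j' : Q'.H → P.H} (F : IsFace ι P Q f j)
    (F' : IsFace ι P Q' f' j') : Nonempty (Q.Iso Q') := by
  classical
  have hk : ∀ u v, f u = f v ↔ f' u = f' v := fun u v => (F.ker u v).trans (F'.ker u v).symm
  let φ : Q.V → Q'.V := fun c => f' (Function.surjInv F.surj c)
  have hφ : ∀ v, φ (f v) = f' v := fun v => (hk _ _).1 (Function.surjInv_eq F.surj (f v))
  have φb : Function.Bijective φ := by
    constructor
    · intro a b
      obtain ⟨u, rfl⟩ := F.surj a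
      obtain ⟨v, rfl⟩ := F.surj b
      rw [hφ, hφ]
      exact (hk _ _).2
    · intro c
      obtain ⟨u, rfl⟩ := F'.surj c
      exact ⟨f u, hφ u⟩
  have hr : Set.range j = Set.range j' := by
    ext h
    rw [F.range_j, F'.range_j]
  let ψ : Q.H ≃ Q'.H := (Equiv.ofInjective j F.inj).trans
    ((Equiv.setCongr hr).trans (Equiv.ofInjective j' F'.inj).symm)
  have hψ : ∀ h, j' (ψ h) = j h := fun h =>
    Equiv.apply_ofInjective_symm F'.inj (Equiv.setCongr hr (Equiv.ofInjective j F.inj h))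
  refine ⟨⟨Equiv.ofBijective φ φb, ψ, fun h => ?_, fun h => ?_, fun c => ?_, fun h => ?_⟩⟩
  · change _ = φ (Q.r h)
    rw [← F.r_j, ← F'.r_j, hφ, hψ]
  · apply F'.inj
    rw [← F'.s_j, hψ, hψ, F.s_j]
  · have e : ∀ v, (f' v = φ c) ↔ (f v = c) := by
      intro v
      rw [← hφ]
      exact φb.1.eq_iff
    have h1 := F.weight c
    have h2 := F'.weight (φ c)
    simp only [e] at h2
    rw [← h1] at h2
    exact_mod_cast h2
  · apply ι.injective
    change ι (Q'.lab (ψ h)) = ι (Q.lab h)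
    rw [← F.lab_j, ← F'.lab_j, hψ]

theorem comp {κ : Fin m ↪ Fin k} {R : LabelledPair g m} {f' : Q.V → R.V} {j' : R.H → Q.H}
    (F : IsFace ι P Q f j) (F' : IsFace κ Q R f' j') :
    IsFace (κ.trans ι) P R (f' ∘ f) (j ∘ j') where
  surj := F'.surj.comp F.surj
  lab_j h := by simp [F.lab_j, F'.lab_j]
  s_j h := by simp [F.s_j, F'.s_j]
  r_j h := by simp [F.r_j, F'.r_j]
  ker u v := by
    have hsub : ∀ i, i ∉ Set.range ι → i ∉ Set.range (κ.trans ι) := by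
      rintro i hi ⟨x, rfl⟩
      exact hi ⟨κ x, rfl⟩
    have hmono : ∀ u v, f u = f v → Relation.EqvGen (fun a b => ∃ h,
        P.lab h ∉ Set.range (κ.trans ι) ∧ P.r h = a ∧ P.r (P.s h) = b) u v := by
      intro u v h
      refine Relation.EqvGen.mono ?_ _ _ ((F.ker u v).1 h)
      rintro a b ⟨h, hh, e⟩
      exact ⟨h, hsub _ hh, e⟩
    constructor
    · intro h
      have h' := (F'.ker _ _).1 h
      have aux : ∀ c d, Relation.EqvGen (fun a b => ∃ h, Q.lab h ∉ Set.range κ ∧ Q.r h = a ∧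
          Q.r (Q.s h) = b) c d → ∀ u v, f u = c → f v = d → Relation.EqvGen (fun a b => ∃ h,
          P.lab h ∉ Set.range (κ.trans ι) ∧ P.r h = a ∧ P.r (P.s h) = b) u v := by
        intro c d hcd
        induction hcd with
        | rel c d hcd =>
          obtain ⟨h, hh, rfl, rfl⟩ := hcd
          intro u v hu hv
          refine ((hmono u _ (hu.trans (F.r_j h).symm)).trans _ _ _
            (Relation.EqvGen.rel (P.r (j h)) (P.r (P.s (j h))) ⟨j h, ?_, rfl, rfl⟩)).trans _ _ _
            (hmono _ v ?_)
          · rintro ⟨x, hx⟩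
            rw [F.lab_j] at hx
            exact hh ⟨x, ι.injective hx⟩
          · rw [F.s_j, F.r_j, hv]
        | refl c => intro u v hu hv; exact hmono _ _ (hu.trans hv.symm)
        | symm c d _ ih => intro u v hu hv; exact (ih v u hv hu).symm _ _
        | trans a b c _ _ ih1 ih2 =>
          intro u v hu hv
          obtain ⟨x, hx⟩ := F.surj b
          exact (ih1 u x hu hx).trans _ _ _ (ih2 x v hx hv)
      exact aux _ _ h' u v rfl rfl
    · intro h
      induction h with
      | rel a b h =>
        obtain ⟨h, hh, rfl, rfl⟩ := h
        by_cases hi : P.lab h ∈ Set.range ι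
        · obtain ⟨x, rfl⟩ := (F.range_j h).2 hi
          simp only [Function.comp_apply]
          rw [F.s_j, F.r_j, F.r_j]
          refine (F'.f_s ?_).symm
          rintro ⟨y, hy⟩
          exact hh ⟨y, by rw [F.lab_j, ← hy]; rfl⟩
        · exact congrArg f' (F.f_s hi).symm
      | refl => rfl
      | symm _ _ _ ih => exact ih.symm
      | trans _ _ _ _ _ ih1 ih2 => exact ih1.trans ih2
  weight c := by
    classical
    have hw : ∑ d with f' d = c, ∑ v with f v = d, (P.w v : ℤ) =
        ∑ v with (f' ∘ f) v = c, (P.w v : ℤ) := by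
      rw [← Finset.sum_fiberwise_of_maps_to (s := Finset.univ.filter fun v => (f' ∘ f) v = c)
        (t := Finset.univ.filter fun d => f' d = c) (g := f) (fun v hv => by simpa using hv)]
      refine Finset.sum_congr rfl fun d hd => Finset.sum_congr ?_ fun _ _ => rfl
      ext v
      simp only [Finset.mem_filter, Finset.mem_univ, true_and] at hd ⊢
      exact ⟨fun e => ⟨by simp [e, hd], e⟩, fun e => e.2⟩
    have hv : ∑ d with f' d = c, ((Finset.univ.filter fun v => f v = d).card : ℤ) =
        (Finset.univ.filter fun v => (f' ∘ f) v = c).card := by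
      rw [Finset.card_eq_sum_card_fiberwise (s := Finset.univ.filter fun v => (f' ∘ f) v = c)
        (t := Finset.univ.filter fun d => f' d = c) (f := f) (fun v hv => by simpa using hv)]
      push_cast
      refine Finset.sum_congr rfl fun d hd => ?_
      congr 2
      ext v
      simp only [Finset.mem_filter, Finset.mem_univ, true_and] at hd ⊢
      exact ⟨fun e => ⟨by simp [e, hd], e⟩, fun e => e.2⟩
    set A : Q.V → Finset (Fin l) := fun d => Finset.univ.filter fun i : Fin l =>
      i ∉ Set.range ι ∧ ∃ h, P.lab h = i ∧ f (P.r h) = d with hA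
    set B : Finset (Fin k) := Finset.univ.filter fun i : Fin k =>
      i ∉ Set.range κ ∧ ∃ h, Q.lab h = i ∧ f' (Q.r h) = c with hB
    set C : Finset (Fin l) := Finset.univ.filter fun i : Fin l =>
      i ∉ Set.range (κ.trans ι) ∧ ∃ h, P.lab h = i ∧ (f' ∘ f) (P.r h) = c with hC
    have memA : ∀ h d, P.lab h ∈ A d ↔ P.lab h ∉ Set.range ι ∧ f (P.r h) = d := by
      intro h d
      simp only [hA, Finset.mem_filter, Finset.mem_univ, true_and]
      exact and_congr_right fun hh => F.exists_lab_iff hh d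
    have he : C = ((Finset.univ.filter fun d => f' d = c).biUnion A) ∪ B.map ι := by
      ext i
      rw [Finset.mem_union]
      by_cases hi : i ∈ Set.range ι
      · obtain ⟨x, rfl⟩ := hi
        have h1 : ι x ∉ (Finset.univ.filter fun d => f' d = c).biUnion A := by
          simp [hA]
        rw [or_iff_right h1, Finset.mem_map' ι]
        simp only [hB, hC, Finset.mem_filter, Finset.mem_univ, true_and]
        refine and_congr (not_congr ?_) ?_
        · constructor
          · rintro ⟨y, hy⟩
            exact ⟨y, ι.injective hy⟩
          · rintro ⟨y, rfl⟩
            exact ⟨y, rfl⟩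
        · constructor
          · rintro ⟨h, e, e'⟩
            obtain ⟨a, rfl⟩ := (F.range_j h).2 ⟨x, e.symm⟩
            refine ⟨a, ι.injective ((F.lab_j a).symm.trans e), ?_⟩
            rw [← F.r_j]; exact e'
          · rintro ⟨a, rfl, e'⟩
            exact ⟨j a, F.lab_j a, by rw [Function.comp_apply, F.r_j, e']⟩
      · have h1 : i ∉ B.map ι := by
          intro h
          obtain ⟨x, -, rfl⟩ := Finset.mem_map.1 h
          exact hi ⟨x, rfl⟩
        rw [or_iff_left h1]
        have h2 : i ∉ Set.range (κ.trans ι) := by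
          rintro ⟨x, rfl⟩
          exact hi ⟨κ x, rfl⟩
        simp only [hC, Finset.mem_filter, Finset.mem_univ, true_and, Finset.mem_biUnion, hA]
        constructor
        · rintro ⟨_, h, e, e'⟩
          exact ⟨_, e', hi, h, e, rfl⟩
        · rintro ⟨d, hd, _, h, e, e'⟩
          exact ⟨h2, h, e, by rw [Function.comp_apply, e', hd]⟩
    have hcard : C.card = ∑ d with f' d = c, (A d).card + B.card := by
      rw [he, Finset.card_union_of_disjoint, Finset.card_map, Finset.card_biUnion]
      · intro d _ d' _ hdd
        rw [Function.onFun, Finset.disjoint_left]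
        intro i
        obtain ⟨h, rfl⟩ := P.lab_surjective i
        rw [memA, memA]
        rintro ⟨_, e⟩ ⟨_, e'⟩
        exact hdd (e.symm.trans e')
      · rw [Finset.disjoint_left]
        intro i hi hi'
        obtain ⟨x, -, rfl⟩ := Finset.mem_map.1 hi'
        obtain ⟨d, -, hd⟩ := Finset.mem_biUnion.1 hi
        simp [hA] at hd
    have hcard' : (C.card : ℤ) = ∑ d with f' d = c, ((A d).card : ℤ) + B.card := by
      exact_mod_cast hcard
    rw [F'.weight c, Finset.sum_congr rfl fun d _ => F.weight d]
    simp only [Finset.sum_add_distrib, Finset.sum_sub_distrib, hw, hv, Finset.sum_const,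
      nsmul_eq_mul, mul_one]
    rw [hcard']
    ring

end IsFace

theorem isFace_of_iso {P Q : LabelledPair g k} (φ : P.Iso Q) :
    IsFace (Function.Embedding.refl _) P Q φ.onV φ.onH.symm where
  surj := φ.onV.surjective
  lab_j h := by
    change P.τ (P.edge (φ.onH.symm h)) = Q.τ (Q.edge h)
    rw [← φ.map_τ, Equiv.apply_symm_apply]
  s_j h := by rw [Equiv.eq_symm_apply, ← φ.map_s, Equiv.apply_symm_apply]
  r_j h := by rw [← φ.map_r, Equiv.apply_symm_apply]
  ker u v := by
    rw [φ.onV.injective.eq_iff]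
    constructor
    · rintro rfl; exact Relation.EqvGen.refl _
    · intro h
      induction h with
      | rel a b h =>
        obtain ⟨h, hh, -⟩ := h
        exact absurd ⟨_, rfl⟩ hh
      | refl => rfl
      | symm _ _ _ ih => exact ih.symm
      | trans _ _ _ _ _ ih1 ih2 => exact ih1.trans ih2
  weight c := by
    classical
    have h1 : (Finset.univ.filter fun v => φ.onV v = c) = {φ.onV.symm c} := by
      ext v
      simp [Equiv.eq_symm_apply]
    have h2 := φ.map_w (φ.onV.symm c)
    rw [Equiv.apply_symm_apply] at h2
    rw [h1, h2]
    simp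

open Classical in
theorem contractWeight_lab (ι : Fin k ↪ Fin l) (P : LabelledPair g l)
    (c : (P.toHalfEdgeGraph.contract (P.offImage ι)).V) :
    (P.toHalfEdgeGraph.contractWeight (P.offImage ι) P.w c : ℤ) =
      ∑ v with P.toContract (P.offImage ι) v = c, (P.w v : ℤ) +
      ((Finset.univ.filter fun i : Fin l => i ∉ Set.range ι ∧
        ∃ h, P.lab h = i ∧ P.toContract (P.offImage ι) (P.r h) = c).card
      - (Finset.univ.filter fun v => P.toContract (P.offImage ι) v = c).card + 1) := by
  rw [HalfEdgeGraph.contractWeight_cast]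
  have h1 : P.vertsOver (P.offImage ι) c =
      Finset.univ.filter fun v => P.toContract (P.offImage ι) v = c := by
    ext v
    simp [HalfEdgeGraph.mem_vertsOver]
  have h2 : (P.edgesOver (P.offImage ι) c).card = (Finset.univ.filter fun i : Fin l =>
      i ∉ Set.range ι ∧ ∃ h, P.lab h = i ∧ P.toContract (P.offImage ι) (P.r h) = c).card := by
    rw [← Finset.card_map P.τ.toEmbedding]
    congr 1
    ext i
    obtain ⟨h, rfl⟩ := P.lab_surjective i
    have e : P.τ.symm (P.lab h) = P.edge h := P.τ.symm_apply_apply _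
    rw [Finset.mem_map_equiv, e, HalfEdgeGraph.edgesOver, Finset.mem_filter, Finset.mem_filter]
    refine and_congr (by simp) (and_congr Iff.rfl (exists_congr fun h' => and_congr_left' ?_))
    exact P.τ.injective.eq_iff.symm
  rw [h1, h2]

theorem isFace_face (ι : Fin k ↪ Fin l) (P : LabelledPair g l) :
    IsFace ι P (P.face ι) (P.toContract (P.offImage ι)) Subtype.val where
  surj c := Quot.exists_rep c
  lab_j h := by
    symm
    exact congrArg Subtype.val (Equiv.apply_symm_apply (Equiv.ofInjective ι ι.injective) _)
  s_j h := rfl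
  r_j h := rfl
  ker u v := ⟨fun h => Quot.eqvGen_exact h, fun h => Quot.eqvGen_sound h⟩
  weight c := by
    convert contractWeight_lab ι P c
    · rfl
    all_goals exact Iff.rfl

theorem face_congr (ι : Fin k ↪ Fin l) {P P' : LabelledPair g l} (h : P ≈ P') :
    P.face ι ≈ P'.face ι := by
  obtain ⟨φ⟩ := h
  exact (isFace_face ι P).unique ((isFace_of_iso φ).comp (isFace_face ι P'))

theorem face_refl (P : LabelledPair g k) : P.face (Function.Embedding.refl _) ≈ P :=
  (isFace_face _ P).unique (isFace_of_iso ⟨Equiv.refl _, Equiv.refl _, fun _ => rfl, fun _ => rfl,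
    fun _ => rfl, fun _ => rfl⟩)

theorem face_trans (κ : Fin m ↪ Fin k) (ι : Fin k ↪ Fin l) (P : LabelledPair g l) :
    P.face (κ.trans ι) ≈ (P.face ι).face κ :=
  (isFace_face _ P).unique ((isFace_face ι P).comp (isFace_face κ _))

end LabelledPair

/-! ### Symmetric Δ-complexes -/

/-- The category `I` of the finite sets `[p] = {0, …, p}` for `p ≥ -1` and injections. An object is
recorded by its size `p + 1`. -/
structure SymmIndex : Type where
  size : ℕ

instance : Category SymmIndex where
  Hom a b := Fin a.size ↪ Fin b.size
  id a := Function.Embedding.refl _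
  comp f h := f.trans h

/-- A symmetric Δ-complex is a functor from `I` (reversed) to sets; morphisms are natural
transformations. -/
abbrev SymmDeltaComplex : Type 2 := SymmIndexᵒᵖ ⥤ Type 1

/-- The simplices of `Δ_g` with `k` vertices (dimension `k - 1`): isomorphism classes of stable
graphs of genus `g` with `k` labelled edges. -/
def Simplices (g k : ℕ) : Type 1 := Quotient (LabelledPair.setoid g k)

/-- The face maps of `Δ_g`. -/
def Simplices.face {g k l : ℕ} (ι : Fin k ↪ Fin l) : Simplices g l → Simplices g k :=
  Quotient.map (LabelledPair.face ι) fun _ _ h => LabelledPair.face_congr ι h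

/-- The symmetric Δ-complex `Δ_g`. -/
def Delta (g : ℕ) : SymmDeltaComplex where
  obj a := Simplices g a.unop.size
  map f := TypeCat.ofHom (Simplices.face f.unop)
  map_id a := by
    ext x
    induction x using Quotient.inductionOn with
    | _ P => exact Quotient.sound (LabelledPair.face_refl P)
  map_comp f h := by
    ext x
    induction x using Quotient.inductionOn with
    | _ P => exact Quotient.sound (LabelledPair.face_trans h.unop f.unop P)

/-- The number of vertices of the graph underlying a simplex of `Δ_g`. -/
def Simplices.numVertices {g k : ℕ} : Simplices g k → ℕ :=
  Quotient.lift (fun P : LabelledPair g k => Fintype.card P.V)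
    fun _ _ ⟨φ⟩ => Fintype.card_congr φ.onV

theorem Simplices.numVertices_face {g k l : ℕ} (ι : Fin k ↪ Fin l) (x : Simplices g l) :
    (x.face ι).numVertices ≤ x.numVertices := by
  induction x using Quotient.inductionOn with
  | _ P => exact Fintype.card_le_of_surjective _ (LabelledPair.isFace_face ι P).surj

/-- The subcomplex `V^i_g` of `Δ_g` of the graphs with at most `i` vertices. -/
def vertexSubcomplex (g i : ℕ) : Subfunctor (Delta g) where
  obj _ := {x : Simplices g _ | x.numVertices ≤ i}
  map f _ hx := (Simplices.numVertices_face f.unop _).trans hx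

end TropicalModuli

end

/-!
An automorphism `Φ` of `Δ_g` is treated as a family of bijections `FaceEquiv g` that commutes with
all face maps. Only two kinds of face maps are used: the contraction of a single edge (`facet`) and
the permutations of the labels. A labelled stable graph is studied through the function `ends` from
labels to unordered pairs of vertices.

*The number of vertices is preserved.* The simplex given by two vertices of weight zero and `g + 1`
parallel edges is invariant under all permutations of labels, hence so is its image. By
`IsSymmetric.ends_and_card` any invariant simplex with `g + 1` edges has two vertices and no
loops, so its facets have one vertex. A graph with one vertex is determined by its number of edges,
and all of them are faces of such a facet; so `Φ` preserves the graphs with one vertex. Contracting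
an edge lowers the number of vertices by one or zero, according as the edge is not or is a loop,
and `FaceEquiv.numVertices_app` follows by induction. In particular `Φ` preserves loops.

*Full graphs suffice.* Every weight can be replaced by loops (`exists_loop`), so every simplex is a
face of a full one, one with all weights zero. By the genus formula the numbers of edges and
vertices show which simplices are full. It remains to prove `Φ x = x` for full `x`, by induction on
the number of vertices.

*Two vertices.* A full graph with two vertices is determined by its loops and by the relation "at
the same vertex" among them. If there are at least three loops, two of them are at the same vertex
exactly when exchanging their labels leaves the simplex unchanged, and this property is preserved
by `Φ`. The case of two loops is reduced to this one (`ends_eq_of_two_loops`).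

*Three or more vertices.* By induction `x` and `Φ x` have the same contractions by all edges that
are not loops. Once the set of edges at one vertex of `x` is also the set of edges at a vertex of
`Φ x`, the two agree, by `exists_equiv_of_star`. Such a vertex is found by comparing the
contractions of one edge: a vertex off that edge stays visible unless it corresponds to the merged
vertex, which can happen for at most one of two vertices. With three vertices there is only one
vertex off a given edge, and two edges have to be compared.
-/

namespace TropicalModuli

/-! ### Reconstruction of edge-labelled graphs from single-edge contractions -/

section Reconstruction

variable {ι V W M : Type}

/-- A graph with edge set `ι` is given here by the function `p` that sends an edge to its unordered
pair of ends. `Merges p i f` says that `f` identifies the ends of the edge `i` and nothing else. -/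
def Merges (p : ι → Sym2 V) (i : ι) (f : V → M) : Prop :=
  Function.Surjective f ∧ ∀ u v, f u = f v ↔ u = v ∨ p i = s(u, v)

/-- The graphs `p` and `q` become isomorphic, compatibly with the names of the remaining edges,
when `i` is contracted in both of them. -/
def SameContraction (p : ι → Sym2 V) (q : ι → Sym2 W) (i : ι) : Prop :=
  ∃ (M : Type) (f : V → M) (f' : W → M), Merges p i f ∧ Merges q i f' ∧
    ∀ j, j ≠ i → (p j).map f = (q j).map f'

/-- Connectedness: a nonempty set of vertices closed under adjacency is everything. -/
def IsJoined (p : ι → Sym2 V) : Prop :=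
  ∀ S : Set V, S.Nonempty → (∀ i a b, p i = s(a, b) → a ∈ S → b ∈ S) → S = Set.univ

/-- The vertex `v` carries a loop or is incident to at least three edges. In a connected graph with
more than one vertex this says that `v` has valence at least three. -/
def IsThick (p : ι → Sym2 V) (v : V) : Prop :=
  (∃ i, p i = s(v, v)) ∨ ∃ i j k, i ≠ j ∧ i ≠ k ∧ j ≠ k ∧ v ∈ p i ∧ v ∈ p j ∧ v ∈ p k

theorem exists_ne_ne_of_three {α : Type} {s : α → Prop} {i j k : α} (hij : i ≠ j) (hik : i ≠ k)
    (hjk : j ≠ k) (hi : s i) (hj : s j) (hk : s k) (a b : α) : ∃ t, t ≠ a ∧ t ≠ b ∧ s t := by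
  by_contra! h
  have h' : ∀ t, s t → t = a ∨ t = b := fun t ht => by
    by_contra! e
    exact h t e.1 e.2 ht
  have := h' i hi
  have := h' j hj
  have := h' k hk
  grind

theorem sym2_eq_mk_of_mem {z : Sym2 V} {v : V} (h : v ∈ z) : ∃ u, z = s(v, u) := h

theorem exists_eq_diag {z : Sym2 V} (h : z.IsDiag) : ∃ a, z = s(a, a) := by
  induction z using Sym2.ind with
  | _ a b => exact ⟨a, by rw [Sym2.mk_isDiag_iff.1 h]⟩

theorem not_isDiag_iff_exists {z : Sym2 V} : ¬ z.IsDiag ↔ ∃ a b, a ≠ b ∧ z = s(a, b) := by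
  constructor
  · intro h
    induction z using Sym2.ind with
    | _ a b => exact ⟨a, b, fun e => h (Sym2.mk_isDiag_iff.2 e), rfl⟩
  · rintro ⟨a, b, h, rfl⟩
    simpa using h

theorem Merges.map_isDiag_iff {p : ι → Sym2 V} {i : ι} {f : V → M} (h : Merges p i f) (z : Sym2 V) :
    (z.map f).IsDiag ↔ z.IsDiag ∨ z = p i := by
  induction z using Sym2.ind with
  | _ a b => simp [h.2, eq_comm]

theorem Merges.card [Fintype V] [Fintype M] {p : ι → Sym2 V} {i : ι} {f : V → M}
    (hf : Merges p i f) (hi : ¬ (p i).IsDiag) : Fintype.card M + 1 = Fintype.card V := by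
  classical
  obtain ⟨a, b, hab, h⟩ := not_isDiag_iff_exists.1 hi
  have hb : Function.Bijective fun t : {t : V // t ≠ a} => f t := by
    constructor
    · rintro ⟨s, hs⟩ ⟨t, ht⟩ e
      rcases (hf.2 _ _).1 e with e | e
      · exact Subtype.ext e
      · have : a ∈ s(s, t) := e ▸ h ▸ Sym2.mem_mk_left a b
        rcases Sym2.mem_iff.1 this with e | e
        · exact absurd e.symm hs
        · exact absurd e.symm ht
    · intro m
      obtain ⟨t, rfl⟩ := hf.1 m
      by_cases ht : t = a
      · exact ⟨⟨b, hab.symm⟩, by rw [ht]; exact ((hf.2 _ _).2 (Or.inr h)).symm⟩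
      · exact ⟨⟨t, ht⟩, rfl⟩
  rw [← Fintype.card_of_bijective hb, Fintype.card_subtype_compl, Fintype.card_subtype_eq]
  have : 0 < Fintype.card V := Fintype.card_pos_iff.2 ⟨a⟩
  omega

theorem Merges.bijective {p : ι → Sym2 V} {i : ι} {f : V → M}
    (hf : Merges p i f) (hi : (p i).IsDiag) : Function.Bijective f := by
  refine ⟨fun a b e => ?_, hf.1⟩
  rcases (hf.2 _ _).1 e with e | e
  · exact e
  · rwa [e, Sym2.mk_isDiag_iff] at hi

theorem IsJoined.exists_ne_adj {p : ι → Sym2 V} (hp : IsJoined p) {v u : V} (huv : u ≠ v) :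
    ∃ i w, w ≠ v ∧ p i = s(v, w) := by
  by_contra! h
  have := hp {v} ⟨v, rfl⟩ (fun i a b hi ha => by
    rw [Set.mem_singleton_iff] at ha ⊢
    subst ha
    by_contra hb
    exact h i b hb hi)
  exact huv (this ▸ Set.mem_univ u : u ∈ ({v} : Set V))

/-- Let `v` and `v'` be incident to the same edges. If the ends of `i` at `v` and at `v'` become the
same vertex of the common contraction, then that contraction determines both graphs, because each
is recovered from it by splitting off the vertex `v`, respectively `v'`. -/
theorem exists_equiv_of_contraction_of_star {p : ι → Sym2 V} {q : ι → Sym2 W} {i : ι}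
    {v : V} {v' : W} (hloop : ∀ j, (p j).IsDiag ↔ (q j).IsDiag) (hstar : ∀ j, v ∈ p j ↔ v' ∈ q j)
    (hi : ¬ (p i).IsDiag) (hv : v ∈ p i) {f : V → M} {f' : W → M} (hf : Merges p i f)
    (hf' : Merges q i f') (hff : ∀ j, j ≠ i → (p j).map f = (q j).map f') (hvv : f v = f' v') :
    ∃ φ : V ≃ W, ∀ j, (p j).map φ = q j := by
  classical
  obtain ⟨u, hu⟩ := sym2_eq_mk_of_mem hv
  obtain ⟨u', hu'⟩ := sym2_eq_mk_of_mem ((hstar i).1 hv)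
  have huv : u ≠ v := by rintro rfl; exact hi (by simp [hu])
  have huv' : u' ≠ v' := by rintro rfl; exact hi ((hloop i).2 (by simp [hu']))
  have fu : f u = f v := (hf.2 _ _).2 (Or.inr (by rw [hu, Sym2.eq_swap]))
  have fu' : f' u' = f' v' := (hf'.2 _ _).2 (Or.inr (by rw [hu', Sym2.eq_swap]))
  have inj : ∀ a b, a ≠ v → b ≠ v → f a = f b → a = b := by
    intro a b ha hb h
    rcases (hf.2 _ _).1 h with h | h
    · exact h
    · have : v ∈ s(a, b) := h ▸ hv
      rcases Sym2.mem_iff.1 this with h | h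
      · exact absurd h.symm ha
      · exact absurd h.symm hb
  have inj' : ∀ a b, a ≠ v' → b ≠ v' → f' a = f' b → a = b := by
    intro a b ha hb h
    rcases (hf'.2 _ _).1 h with h | h
    · exact h
    · have : v' ∈ s(a, b) := h ▸ (hstar i).1 hv
      rcases Sym2.mem_iff.1 this with h | h
      · exact absurd h.symm ha
      · exact absurd h.symm hb
  have sur : ∀ m, ∃ w, w ≠ v ∧ f w = m := by
    intro m
    obtain ⟨w, rfl⟩ := hf.1 m
    by_cases h : w = v
    · exact ⟨u, huv, by rw [h, fu]⟩
    · exact ⟨w, h, rfl⟩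
  have sur' : ∀ m, ∃ w, w ≠ v' ∧ f' w = m := by
    intro m
    obtain ⟨w, rfl⟩ := hf'.1 m
    by_cases h : w = v'
    · exact ⟨u', huv', by rw [h, fu']⟩
    · exact ⟨w, h, rfl⟩
  choose a ha1 ha2 using sur
  choose b hb1 hb2 using sur'
  let φ : V → W := fun t => if t = v then v' else b (f t)
  have φv : φ v = v' := if_pos rfl
  have φn : ∀ t, t ≠ v → φ t = b (f t) := fun t ht => if_neg ht
  have φb : Function.Bijective φ := by
    constructor
    · intro s t h
      by_cases hs : s = v <;> by_cases ht : t = v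
      · rw [hs, ht]
      · rw [hs, φv, φn t ht] at h; exact absurd h.symm (hb1 _)
      · rw [ht, φv, φn s hs] at h; exact absurd h (hb1 _)
      · rw [φn s hs, φn t ht] at h
        have := congrArg f' h
        rw [hb2, hb2] at this
        exact inj _ _ hs ht this
    · intro w
      by_cases hw : w = v'
      · exact ⟨v, φv.trans hw.symm⟩
      · refine ⟨a (f' w), ?_⟩
        rw [φn _ (ha1 _), ha2]
        exact inj' _ _ (hb1 _) hw (hb2 _)
  have key : ∀ s t, s ≠ v → t ≠ v' → f s = f' t → φ s = t := by
    intro s t hs ht h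
    rw [φn s hs]
    exact inj' _ _ (hb1 _) ht ((hb2 _).trans h)
  refine ⟨Equiv.ofBijective φ φb, fun j => ?_⟩
  change (p j).map φ = q j
  by_cases hj : v ∈ p j
  · obtain ⟨c, hc⟩ := sym2_eq_mk_of_mem hj
    obtain ⟨d, hd⟩ := sym2_eq_mk_of_mem ((hstar j).1 hj)
    have hl := hloop j
    rw [hc, hd, Sym2.mk_isDiag_iff, Sym2.mk_isDiag_iff] at hl
    rw [hc, hd, Sym2.map_mk, φv]
    by_cases hcv : c = v
    · rw [hcv, φv, ← hl.1 hcv.symm]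
    · have hdv : d ≠ v' := fun h => hcv (hl.2 h.symm).symm
      rw [key c d hcv hdv]
      by_cases hji : j = i
      · subst hji
        have e1 : c = u := Sym2.congr_right.1 (hc.symm.trans hu)
        have e2 : d = u' := Sym2.congr_right.1 (hd.symm.trans hu')
        rw [e1, e2, fu, fu', hvv]
      · have := hff j hji
        rw [hc, hd, Sym2.map_mk, Sym2.map_mk, hvv] at this
        exact Sym2.congr_right.1 this
  · have hj' : v' ∉ q j := fun h => hj ((hstar j).2 h)
    have hji : j ≠ i := by rintro rfl; exact hj hv
    have := hff j hji
    revert this hj hj'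
    generalize p j = x
    generalize q j = y
    induction x using Sym2.ind with
    | _ c d =>
      induction y using Sym2.ind with
      | _ c' d' =>
        intro h1 h2 h
        simp only [Sym2.mem_iff, not_or] at h1 h2
        simp only [Sym2.map_mk, Sym2.eq_iff] at h ⊢
        rcases h with ⟨h, h'⟩ | ⟨h, h'⟩
        · exact Or.inl ⟨key _ _ (Ne.symm h1.1) (Ne.symm h2.1) h,
            key _ _ (Ne.symm h1.2) (Ne.symm h2.2) h'⟩
        · exact Or.inr ⟨key _ _ (Ne.symm h1.1) (Ne.symm h2.2) h,
            key _ _ (Ne.symm h1.2) (Ne.symm h2.1) h'⟩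

/-- A graph is determined by the contractions of its edges once the star of one vertex is known:
among the edges at a thick vertex there is one whose contraction still shows where the merged
vertex is. -/
theorem exists_equiv_of_star {p : ι → Sym2 V} {q : ι → Sym2 W} {v u : V} {v' : W}
    (hp : IsJoined p) (huv : u ≠ v) (hv : IsThick p v)
    (hloop : ∀ j, (p j).IsDiag ↔ (q j).IsDiag) (hstar : ∀ j, v ∈ p j ↔ v' ∈ q j)
    (hcon : ∀ i, ¬ (p i).IsDiag → SameContraction p q i) :
    ∃ φ : V ≃ W, ∀ j, (p j).map φ = q j := by
  by_cases hl : ∃ l, p l = s(v, v)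
  · obtain ⟨l, hl⟩ := hl
    obtain ⟨i, w, hw, hi⟩ := hp.exists_ne_adj huv
    have hid : ¬ (p i).IsDiag := not_isDiag_iff_exists.2 ⟨v, w, hw.symm, hi⟩
    obtain ⟨M, f, f', hf, hf', hff⟩ := hcon i hid
    refine exists_equiv_of_contraction_of_star hloop hstar hid (by simp [hi]) hf hf' hff ?_
    have hql : q l = s(v', v') := by
      obtain ⟨d, hd⟩ := sym2_eq_mk_of_mem ((hstar l).1 (by simp [hl]))
      have := (hloop l).1 (by simp [hl])
      rw [hd, Sym2.mk_isDiag_iff] at this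
      rw [hd, ← this]
    have hli : l ≠ i := by rintro rfl; exact hid (by simp [hl])
    simpa [hl, hql] using hff l hli
  have nd : ∀ j, v ∈ p j → ¬ (p j).IsDiag := by
    intro j hj hd
    obtain ⟨w, hw⟩ := sym2_eq_mk_of_mem hj
    rw [hw, Sym2.mk_isDiag_iff] at hd
    exact hl ⟨j, by rw [hw, ← hd]⟩
  by_cases hpar : ∃ i j, i ≠ j ∧ v ∈ p i ∧ p i = p j
  · obtain ⟨i, j, hij, hi, hij'⟩ := hpar
    obtain ⟨M, f, f', hf, hf', hff⟩ := hcon i (nd i hi)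
    refine exists_equiv_of_contraction_of_star hloop hstar (nd i hi) hi hf hf' hff ?_
    -- the edge `j` becomes a loop at the merged vertex
    have hd : ((p j).map f).IsDiag := (hf.map_isDiag_iff _).2 (Or.inr hij'.symm)
    have h := hff j hij.symm
    obtain ⟨a, ha⟩ := sym2_eq_mk_of_mem (hij' ▸ hi : v ∈ p j)
    obtain ⟨b, hb⟩ := sym2_eq_mk_of_mem ((hstar j).1 (hij' ▸ hi : v ∈ p j))
    have hd' := h ▸ hd
    rw [ha, Sym2.map_mk, Sym2.mk_isDiag_iff] at hd
    rw [hb, Sym2.map_mk, Sym2.mk_isDiag_iff] at hd'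
    rw [ha, hb, Sym2.map_mk, Sym2.map_mk, ← hd, ← hd'] at h
    simpa using h
  · obtain ⟨e₁, e₂, e₃, h12, h13, h23, m1, m2, m3⟩ := hv.resolve_left hl
    push Not at hpar
    obtain ⟨u₁, hu₁⟩ := sym2_eq_mk_of_mem m1
    obtain ⟨u₂, hu₂⟩ := sym2_eq_mk_of_mem m2
    obtain ⟨u₃, hu₃⟩ := sym2_eq_mk_of_mem m3
    obtain ⟨w₂, hw₂⟩ := sym2_eq_mk_of_mem ((hstar _).1 m2)
    obtain ⟨w₃, hw₃⟩ := sym2_eq_mk_of_mem ((hstar _).1 m3)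
    obtain ⟨M, f, f', hf, hf', hff⟩ := hcon e₁ (nd _ m1)
    refine exists_equiv_of_contraction_of_star hloop hstar (nd _ m1) m1 hf hf' hff ?_
    -- the merged vertex is the only common end of `e₂` and `e₃` in the contraction
    by_contra hne
    have h2 := hff e₂ h12.symm
    have h3 := hff e₃ h13.symm
    rw [hu₂, hw₂, Sym2.map_mk, Sym2.map_mk, Sym2.eq_iff] at h2
    rw [hu₃, hw₃, Sym2.map_mk, Sym2.map_mk, Sym2.eq_iff] at h3
    have g2 := (h2.resolve_left fun h => hne h.1).2
    have g3 := (h3.resolve_left fun h => hne h.1).2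
    rcases (hf.2 _ _).1 (g2.trans g3.symm) with h | h
    · exact hpar e₂ e₃ h23 m2 (by rw [hu₂, hu₃, h])
    · have : v ∈ s(u₂, u₃) := h ▸ m1
      rcases Sym2.mem_iff.1 this with h | h
      · exact nd _ m2 (by rw [hu₂, ← h]; simp)
      · exact nd _ m3 (by rw [hu₃, ← h]; simp)

/-- A vertex off the edge `i` that does not correspond to the merged vertex of the contraction of
`q` is visible as a vertex of `q` with the same star. -/
theorem exists_same_star {p : ι → Sym2 V} {q : ι → Sym2 W} {i : ι} {w : V} {a' b' : W}
    (hw : w ∉ p i) (hq : q i = s(a', b')) {f : V → M} {f' : W → M} (hf : Merges p i f)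
    (hf' : Merges q i f') (hff : ∀ j, j ≠ i → (p j).map f = (q j).map f') (hne : f w ≠ f' a') :
    ∃ w', ∀ j, w ∈ p j ↔ w' ∈ q j := by
  obtain ⟨w', hw'⟩ := hf'.1 (f w)
  have hab : f' a' = f' b' := (hf'.2 _ _).2 (Or.inr hq)
  have hw'i : w' ∉ q i := by
    rw [hq, Sym2.mem_iff]
    rintro (rfl | rfl)
    · exact hne hw'.symm
    · exact hne (hw'.symm.trans hab.symm)
  refine ⟨w', fun j => ?_⟩
  by_cases hji : j = i
  · subst hji
    exact iff_of_false hw hw'i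
  have h1 : f w ∈ (p j).map f ↔ w ∈ p j := by
    rw [Sym2.mem_map]
    refine ⟨?_, fun h => ⟨w, h, rfl⟩⟩
    rintro ⟨t, ht, e⟩
    rcases (hf.2 _ _).1 e with rfl | e
    · exact ht
    · exact absurd (e ▸ Sym2.mem_mk_right t w : w ∈ p i) hw
  have h2 : f' w' ∈ (q j).map f' ↔ w' ∈ q j := by
    rw [Sym2.mem_map]
    refine ⟨?_, fun h => ⟨w', h, rfl⟩⟩
    rintro ⟨t, ht, e⟩
    rcases (hf'.2 _ _).1 e with rfl | e
    · exact ht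
    · exact absurd (e ▸ Sym2.mem_mk_right t w' : w' ∈ q i) hw'i
  rw [← h1, ← h2, hff j hji, hw']

/-- On at least four vertices there are two vertices off a given edge, and only one of them can
correspond to the merged vertex. -/
theorem exists_equiv_of_four_le [Fintype V] {p : ι → Sym2 V} {q : ι → Sym2 W}
    (hp : IsJoined p) (hthick : ∀ v, IsThick p v) (hV : 4 ≤ Fintype.card V)
    (hloop : ∀ j, (p j).IsDiag ↔ (q j).IsDiag)
    (hcon : ∀ i, ¬ (p i).IsDiag → SameContraction p q i) :
    ∃ φ : V ≃ W, ∀ j, (p j).map φ = q j := by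
  classical
  obtain ⟨x, y, hxy⟩ := Fintype.exists_pair_of_one_lt_card (by omega : 1 < Fintype.card V)
  obtain ⟨i, z, hz, hi⟩ := hp.exists_ne_adj hxy.symm
  have hid : ¬ (p i).IsDiag := not_isDiag_iff_exists.2 ⟨x, z, hz.symm, hi⟩
  have hcard : 1 < (({x, z} : Finset V)ᶜ).card := by
    rw [Finset.card_compl, Finset.card_pair hz.symm]; omega
  obtain ⟨w₁, h1, w₂, h2, h12⟩ := Finset.one_lt_card.1 hcard
  simp only [Finset.mem_compl, Finset.mem_insert, Finset.mem_singleton, not_or] at h1 h2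
  have n1 : w₁ ∉ p i := by simp [hi, h1]
  have n2 : w₂ ∉ p i := by simp [hi, h2]
  obtain ⟨M, f, f', hf, hf', hff⟩ := hcon i hid
  obtain ⟨a', b', -, hq⟩ := not_isDiag_iff_exists.1 (mt (hloop i).2 hid)
  have : f w₁ ≠ f w₂ := by
    intro h
    rcases (hf.2 _ _).1 h with h | h
    · exact h12 h
    · exact n1 (h ▸ Sym2.mem_mk_left _ _)
  have h : ∃ w w', w ≠ x ∧ ∀ j, w ∈ p j ↔ w' ∈ q j := by
    by_cases e : f w₁ = f' a'
    · obtain ⟨w', h⟩ := exists_same_star n2 hq hf hf' hff (fun e' => this (e.trans e'.symm))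
      exact ⟨w₂, w', h2.1, h⟩
    · obtain ⟨w', h⟩ := exists_same_star n1 hq hf hf' hff e
      exact ⟨w₁, w', h1.1, h⟩
  obtain ⟨w, w', hw, h⟩ := h
  exact exists_equiv_of_star hp hw.symm (hthick w) hloop h hcon

/-- A connected graph with three vertices contains a path `u - v - w`. -/
theorem IsJoined.exists_path [Fintype V] {p : ι → Sym2 V} (hp : IsJoined p)
    (hV : Fintype.card V = 3) :
    ∃ u v w i j, u ≠ v ∧ w ≠ v ∧ u ≠ w ∧ (∀ t, t = u ∨ t = v ∨ t = w) ∧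
      p i = s(v, u) ∧ p j = s(v, w) := by
  classical
  obtain ⟨x, y, hxy⟩ := Fintype.exists_pair_of_one_lt_card (by omega : 1 < Fintype.card V)
  obtain ⟨i, y, hy, hi⟩ := hp.exists_ne_adj hxy.symm
  have hcard : (({x, y} : Finset V)ᶜ).card = 1 := by
    rw [Finset.card_compl, Finset.card_pair hy.symm]; omega
  obtain ⟨z, hz⟩ := Finset.card_eq_one.1 hcard
  have hzm : z ∈ (({x, y} : Finset V)ᶜ) := by simp [hz]
  have hall : ∀ t, t = x ∨ t = y ∨ t = z := by
    intro t
    by_cases ht : t ∈ (({x, y} : Finset V)ᶜ)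
    · rw [hz, Finset.mem_singleton] at ht; exact Or.inr (Or.inr ht)
    · simp only [Finset.mem_compl, not_not, Finset.mem_insert, Finset.mem_singleton] at ht
      tauto
  simp only [Finset.mem_compl, Finset.mem_insert, Finset.mem_singleton, not_or] at hzm
  obtain ⟨j, t, ht, hj⟩ := hp.exists_ne_adj (v := z) (Ne.symm hzm.1)
  rcases hall t with rfl | rfl | rfl
  · exact ⟨y, t, z, i, j, hy, hzm.1, Ne.symm hzm.2, fun s => by have := hall s; tauto, hi,
      by rw [hj, Sym2.eq_swap]⟩
  · exact ⟨x, t, z, i, j, hy.symm, hzm.2, Ne.symm hzm.1, hall,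
      by rw [hi, Sym2.eq_swap], by rw [hj, Sym2.eq_swap]⟩
  · exact absurd rfl ht

/-- If neither end of a path `u - v - w` through all vertices is visible in `q`, then every edge
at `v` belongs to the path, so `v` has valence two. -/
theorem exists_equiv_of_card_eq_three [Fintype V] [Fintype W] {p : ι → Sym2 V} {q : ι → Sym2 W}
    (hp : IsJoined p) (hthick : ∀ v, IsThick p v) (hV : Fintype.card V = 3)
    (hW : Fintype.card W = 3) (hloop : ∀ j, (p j).IsDiag ↔ (q j).IsDiag)
    (hcon : ∀ i, ¬ (p i).IsDiag → SameContraction p q i) :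
    ∃ φ : V ≃ W, ∀ j, (p j).map φ = q j := by
  classical
  obtain ⟨u, v, w, e, f, huv, hwv, huw, hall, he, hf⟩ := hp.exists_path hV
  have hed : ¬ (p e).IsDiag := not_isDiag_iff_exists.2 ⟨v, u, huv.symm, he⟩
  have hfd : ¬ (p f).IsDiag := not_isDiag_iff_exists.2 ⟨v, w, hwv.symm, hf⟩
  obtain ⟨M, c, c', hc, hc', hcc⟩ := hcon e hed
  obtain ⟨N, d, d', hd, hd', hdd⟩ := hcon f hfd
  obtain ⟨a, b, hab, hqe⟩ := not_isDiag_iff_exists.1 (mt (hloop e).2 hed)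
  obtain ⟨a₁, b₁, hab₁, hqf⟩ := not_isDiag_iff_exists.1 (mt (hloop f).2 hfd)
  have hwe : w ∉ p e := by simp [he, hwv, huw.symm]
  have huf : u ∉ p f := by simp [hf, huv, huw]
  by_cases hw : c w = c' a
  swap
  · obtain ⟨w', h⟩ := exists_same_star hwe hqe hc hc' hcc hw
    exact exists_equiv_of_star hp hwv.symm (hthick w) hloop h hcon
  by_cases hu : d u = d' a₁
  swap
  · obtain ⟨w', h⟩ := exists_same_star huf hqf hd hd' hdd hu
    exact exists_equiv_of_star hp huv.symm (hthick u) hloop h hcon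
  exfalso
  have hvu : c v = c u := (hc.2 _ _).2 (Or.inr he)
  have hvw : d v = d w := (hd.2 _ _).2 (Or.inr hf)
  have hcvw : c v ≠ c w := by
    intro h
    rcases (hc.2 _ _).1 h with h | h
    · exact hwv h.symm
    · exact hwe (h ▸ Sym2.mem_mk_right _ _)
  have hdvu : d v ≠ d u := by
    intro h
    rcases (hd.2 _ _).1 h with h | h
    · exact huv h.symm
    · exact huf (h ▸ Sym2.mem_mk_right _ _)
  have hef : e ≠ f := by
    rintro rfl
    exact hwe (by simp [hf])
  have hqne : q e ≠ q f := by
    intro h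
    have h1 : ((q f).map c').IsDiag := (hc'.map_isDiag_iff _).2 (Or.inr h.symm)
    rw [← hcc f hef.symm, hf, Sym2.map_mk, Sym2.mk_isDiag_iff] at h1
    exact hcvw h1
  have hc'a : ∀ t, t ∈ q e → c' t = c w := by
    intro t ht
    rw [hqe, Sym2.mem_iff] at ht
    rcases ht with rfl | rfl
    · exact hw.symm
    · rw [hw]; exact ((hc'.2 _ _).2 (Or.inr hqe)).symm
  have hd'a : ∀ t, t ∈ q f → d' t = d u := by
    intro t ht
    rw [hqf, Sym2.mem_iff] at ht
    rcases ht with rfl | rfl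
    · exact hu.symm
    · rw [hu]; exact ((hd'.2 _ _).2 (Or.inr hqf)).symm
  -- the edges `e` and `f` are distinct pairs of the three vertices of `q`
  have hcover : ∀ t, t ∈ q e ∨ t ∈ q f := by
    intro t
    by_contra! h
    have h1 : (q e).toFinset ⊆ {t}ᶜ := fun x hx => by
      rw [Sym2.mem_toFinset] at hx
      simp only [Finset.mem_compl, Finset.mem_singleton]
      rintro rfl; exact h.1 hx
    have h2 : (q f).toFinset ⊆ {t}ᶜ := fun x hx => by
      rw [Sym2.mem_toFinset] at hx
      simp only [Finset.mem_compl, Finset.mem_singleton]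
      rintro rfl; exact h.2 hx
    have hcard : (({t} : Finset W)ᶜ).card = 2 := by
      rw [Finset.card_compl, Finset.card_singleton, hW]
    have e1 := Finset.eq_of_subset_of_card_le h1
      (by rw [hcard, Sym2.card_toFinset_of_not_isDiag _ (mt (hloop e).2 hed)])
    have e2 := Finset.eq_of_subset_of_card_le h2
      (by rw [hcard, Sym2.card_toFinset_of_not_isDiag _ (mt (hloop f).2 hfd)])
    apply hqne
    ext x
    rw [← Sym2.mem_toFinset, ← Sym2.mem_toFinset, e1, e2]
  by_cases hl : ∃ l, p l = s(v, v)
  · obtain ⟨l, hl⟩ := hl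
    obtain ⟨t, ht⟩ := exists_eq_diag ((hloop l).1 (by simp [hl]))
    have hle : l ≠ e := by rintro rfl; exact hed (by simp [hl])
    have hlf : l ≠ f := by rintro rfl; exact hfd (by simp [hl])
    have h1 : c v = c' t := by simpa [hl, ht] using hcc l hle
    have h2 : d v = d' t := by simpa [hl, ht] using hdd l hlf
    rcases hcover t with h | h
    · exact hcvw (h1.trans (hc'a t h))
    · exact hdvu (h2.trans (hd'a t h))
  · obtain ⟨i, j, k, hij, hik, hjk, mi, mj, mk⟩ := (hthick v).resolve_left hl
    obtain ⟨h, hhe, hhf, mh⟩ :=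
      exists_ne_ne_of_three (s := fun h => v ∈ p h) hij hik hjk mi mj mk e f
    obtain ⟨t, ht⟩ := sym2_eq_mk_of_mem mh
    have hhd : ¬ (q h).IsDiag := by
      rw [← hloop, ht, Sym2.mk_isDiag_iff]
      rintro rfl
      exact hl ⟨h, ht⟩
    -- an edge parallel to a contracted edge becomes a loop at the merged vertex
    rcases hall t with rfl | rfl | rfl
    · have h3 := hcc h hhe
      rw [ht, Sym2.map_mk, ← hvu] at h3
      have h4 := ((hc'.map_isDiag_iff (q h)).1 (by rw [← h3]; simp)).resolve_left hhd
      have h5 : c' a ∈ (q h).map c' := Sym2.mem_map.2 ⟨a, by simp [h4, hqe], rfl⟩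
      rw [← h3, ← hw] at h5
      simp only [Sym2.mem_iff, or_self] at h5
      exact hcvw h5.symm
    · exact hl ⟨h, ht⟩
    · have h3 := hdd h hhf
      rw [ht, Sym2.map_mk, ← hvw] at h3
      have h4 := ((hd'.map_isDiag_iff (q h)).1 (by rw [← h3]; simp)).resolve_left hhd
      have h5 : d' a₁ ∈ (q h).map d' := Sym2.mem_map.2 ⟨a₁, by simp [h4, hqf], rfl⟩
      rw [← h3, ← hu] at h5
      simp only [Sym2.mem_iff, or_self] at h5
      exact hdvu h5.symm

end Reconstruction

variable {g k l : ℕ}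

/-! ### The ends of the labelled edges -/

namespace LabelledPair

/-- A half-edge of the edge with a given label. -/
noncomputable def halfEdge (P : LabelledPair g k) (i : Fin k) : P.H :=
  Function.surjInv P.lab_surjective i

@[simp] theorem lab_halfEdge (P : LabelledPair g k) (i : Fin k) : P.lab (P.halfEdge i) = i :=
  Function.surjInv_eq _ _

/-- The unordered pair of ends of the edge with a given label. -/
noncomputable def ends (P : LabelledPair g k) (i : Fin k) : Sym2 P.V :=
  s(P.r (P.halfEdge i), P.r (P.s (P.halfEdge i)))

theorem ends_lab (P : LabelledPair g k) (h : P.H) : P.ends (P.lab h) = s(P.r h, P.r (P.s h)) := by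
  unfold ends
  rcases lab_eq_iff.1 (P.lab_halfEdge (P.lab h)) with e | e
  · rw [← e]
  · rw [e, P.s_s, Sym2.eq_swap]
    simp [← e]

theorem exists_halfEdge (P : LabelledPair g k) {i : Fin k} {a b : P.V} (h : P.ends i = s(a, b)) :
    ∃ x, P.lab x = i ∧ P.r x = a ∧ P.r (P.s x) = b := by
  rcases Sym2.eq_iff.1 h with ⟨h1, h2⟩ | ⟨h1, h2⟩
  · exact ⟨P.halfEdge i, by simp, h1, h2⟩
  · exact ⟨P.s (P.halfEdge i), by simp, h2, by rw [P.s_s, h1]⟩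

theorem Iso.map_ends {P Q : LabelledPair g k} (φ : P.Iso Q) (i : Fin k) :
    (P.ends i).map φ.onV = Q.ends i := by
  have e : Q.lab (φ.onH (P.halfEdge i)) = i := (φ.map_τ _).trans (P.lab_halfEdge i)
  rw [← e, ends_lab, φ.map_r, φ.map_s, φ.map_r, e]
  rfl

theorem nonempty_iso_of_ends {P Q : LabelledPair g k} (φ : P.V ≃ Q.V)
    (h : ∀ i, (P.ends i).map φ = Q.ends i) (hw : ∀ v, Q.w (φ v) = P.w v) :
    Nonempty (P.Iso Q) := by
  classical
  have hex : ∀ i, ∃ x, Q.lab x = i ∧ Q.r x = φ (P.r (P.halfEdge i)) ∧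
      Q.r (Q.s x) = φ (P.r (P.s (P.halfEdge i))) := fun i =>
    Q.exists_halfEdge (by rw [← h]; rfl)
  choose K hK hK1 hK2 using hex
  let ψ : P.H → Q.H := fun x => if x = P.halfEdge (P.lab x) then K (P.lab x) else Q.s (K (P.lab x))
  have ψ1 : ∀ i, ψ (P.halfEdge i) = K i := fun i => by simp [ψ]
  have ψ2 : ∀ i, ψ (P.s (P.halfEdge i)) = Q.s (K i) := fun i => by
    simp [ψ, P.s_ne]
  have hP : ∀ x : P.H, ∃ i, x = P.halfEdge i ∨ x = P.s (P.halfEdge i) := fun x =>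
    ⟨P.lab x, lab_eq_iff.1 (P.lab_halfEdge _)⟩
  have hψ : Function.Bijective ψ := by
    constructor
    · intro x y e
      have el : ∀ x, Q.lab (ψ x) = P.lab x := by
        intro x
        obtain ⟨i, rfl | rfl⟩ := hP x
        · rw [ψ1, hK, lab_halfEdge]
        · rw [ψ2, lab_s, hK, lab_s, lab_halfEdge]
      have exy : P.lab x = P.lab y := by rw [← el, ← el, e]
      obtain ⟨i, hi⟩ := hP x
      obtain ⟨j, hj⟩ := hP y
      have hij : i = j := by
        have h1 : P.lab x = i := by rcases hi with rfl | rfl <;> simp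
        have h2 : P.lab y = j := by rcases hj with rfl | rfl <;> simp
        rw [← h1, ← h2, exy]
      subst hij
      rcases hi with rfl | rfl <;> rcases hj with rfl | rfl
      · rfl
      · rw [ψ1, ψ2] at e; exact absurd e.symm (Q.s_ne _)
      · rw [ψ1, ψ2] at e; exact absurd e (Q.s_ne _)
      · rfl
    · intro y
      rcases lab_eq_iff.1 (hK (Q.lab y)) with e | e
      · exact ⟨_, (ψ1 _).trans e.symm⟩
      · exact ⟨_, (ψ2 _).trans e.symm⟩
  refine ⟨⟨φ, Equiv.ofBijective ψ hψ, fun x => ?_, fun x => ?_, hw, fun x => ?_⟩⟩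
  all_goals obtain ⟨i, rfl | rfl⟩ := hP x
  · exact (congrArg Q.r (ψ1 i)).trans (hK1 i)
  · exact (congrArg Q.r (ψ2 i)).trans (hK2 i)
  · exact (congrArg Q.s (ψ1 i)).trans (ψ2 i).symm
  · change Q.s (ψ _) = ψ (P.s (P.s _))
    rw [P.s_s, ψ1, ψ2, Q.s_s]
  · change Q.lab (ψ _) = P.lab _
    rw [ψ1, hK, lab_halfEdge]
  · change Q.lab (ψ _) = P.lab _
    rw [ψ2, lab_s, hK, lab_s, lab_halfEdge]

theorem isJoined_ends (P : LabelledPair g k) : IsJoined P.ends := by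
  rintro S ⟨u, hu⟩ hS
  rw [Set.eq_univ_iff_forall]
  intro v
  induction P.connected.2 u v with
  | refl => exact hu
  | tail _ hl ih =>
    obtain ⟨h, -, rfl, rfl⟩ := hl
    exact hS _ _ _ (P.ends_lab h) ih

theorem nonempty_V (P : LabelledPair g k) : Nonempty P.V := P.connected.1

theorem genus_eq_card (P : LabelledPair g k) :
    (k : ℤ) - Fintype.card P.V + 1 + ∑ v, (P.w v : ℤ) = g := by
  have h := P.genus_eq
  unfold HalfEdgeGraph.b1 at h
  rwa [Fintype.card_congr P.τ, Fintype.card_fin] at h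

/-- A labelled stable graph is full if all its weights are zero. This is expressed through the genus
formula by the numbers of edges and vertices, which automorphisms of `Δ_g` preserve; see
`isFull_iff`. -/
def IsFull (P : LabelledPair g k) : Prop := k + 1 = g + Fintype.card P.V

theorem isFull_iff (P : LabelledPair g k) : P.IsFull ↔ ∀ v, P.w v = 0 := by
  have h := P.genus_eq_card
  have : P.IsFull ↔ ∑ v, P.w v = 0 := by
    unfold IsFull
    zify
    constructor <;> intro h' <;> linarith
  rw [this, Finset.sum_eq_zero_iff]
  simp

/-- Three half-edges at a vertex belong to three edges unless two of them form a loop. -/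
theorem isThick_ends (P : LabelledPair g k) {v : P.V} (hv : P.w v = 0) : IsThick P.ends v := by
  classical
  have h := P.stable v
  rw [hv, mul_zero, zero_add] at h
  unfold HalfEdgeGraph.val at h
  obtain ⟨a, ha, b, hb, c, hc, hab, hac, hbc⟩ := Finset.two_lt_card.1 h
  simp only [Finset.mem_filter, Finset.mem_univ, true_and] at ha hb hc
  have hl : ∀ x y, x ≠ y → P.r x = v → P.r y = v → P.lab x = P.lab y →
      ∃ i, P.ends i = s(v, v) := by
    intro x y hxy hx hy e
    rcases lab_eq_iff.1 e with e | e
    · exact absurd e.symm hxy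
    · exact ⟨P.lab x, by rw [ends_lab, ← e, hx, hy]⟩
  by_cases h1 : P.lab a = P.lab b
  · exact Or.inl (hl a b hab ha hb h1)
  by_cases h2 : P.lab a = P.lab c
  · exact Or.inl (hl a c hac ha hc h2)
  by_cases h3 : P.lab b = P.lab c
  · exact Or.inl (hl b c hbc hb hc h3)
  refine Or.inr ⟨_, _, _, h1, h2, h3, ?_, ?_, ?_⟩
  · rw [ends_lab, ← ha]; simp
  · rw [ends_lab, ← hb]; simp
  · rw [ends_lab, ← hc]; simp

theorem exists_isFace (ι : Fin k ↪ Fin l) (P : LabelledPair g l) :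
    ∃ f j, IsFace ι P (P.face ι) f j :=
  ⟨_, _, isFace_face ι P⟩

theorem IsFace.ends_eq {ι : Fin k ↪ Fin l} {P : LabelledPair g l} {Q : LabelledPair g k}
    {f : P.V → Q.V} {j : Q.H → P.H} (F : IsFace ι P Q f j) (i : Fin k) :
    Q.ends i = (P.ends (ι i)).map f := by
  obtain ⟨h, rfl⟩ := Q.lab_surjective i
  rw [← F.lab_j, ends_lab, ends_lab, Sym2.map_mk, F.s_j, F.r_j, F.r_j]

theorem IsFace.merges {i : Fin (k + 1)} {P : LabelledPair g (k + 1)} {Q : LabelledPair g k}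
    {f : P.V → Q.V} {j : Q.H → P.H} (F : IsFace (Fin.succAboveEmb i) P Q f j) :
    Merges P.ends i f := by
  refine ⟨F.surj, fun u v => ?_⟩
  rw [F.ker]
  have hi : ∀ h, P.lab h ∉ Set.range (Fin.succAboveEmb i) ↔ P.lab h = i := by
    intro h
    simp [Fin.range_succAbove]
  constructor
  · intro h
    induction h with
    | rel a b h =>
      obtain ⟨h, hh, rfl, rfl⟩ := h
      rw [hi] at hh
      exact Or.inr (by rw [← hh, ends_lab])
    | refl => exact Or.inl rfl
    | symm _ _ _ ih =>
      rcases ih with rfl | ih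
      · exact Or.inl rfl
      · exact Or.inr (ih.trans Sym2.eq_swap)
    | trans a b c _ _ ih1 ih2 =>
      rcases ih1 with rfl | ih1
      · exact ih2
      · rcases ih2 with rfl | ih2
        · exact Or.inr ih1
        · rw [ih1, Sym2.eq_swap] at ih2
          exact Or.inl (Sym2.congr_right.1 ih2)
  · rintro (rfl | h)
    · exact Relation.EqvGen.refl _
    · obtain ⟨x, h1, h2, h3⟩ := P.exists_halfEdge h
      exact Relation.EqvGen.rel _ _ ⟨x, (hi x).2 h1, h2, h3⟩

theorem IsFace.bijective_of_perm {σ : Equiv.Perm (Fin k)} {P Q : LabelledPair g k}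
    {f : P.V → Q.V} {j : Q.H → P.H} (F : IsFace σ.toEmbedding P Q f j) : Function.Bijective f := by
  refine ⟨fun u v h => ?_, F.surj⟩
  replace h := (F.ker u v).1 h
  induction h with
  | rel a b h =>
    obtain ⟨h, hh, -⟩ := h
    exact absurd ⟨_, σ.apply_symm_apply _⟩ hh
  | refl => rfl
  | symm _ _ _ ih => exact ih.symm
  | trans _ _ _ _ _ ih1 ih2 => exact ih1.trans ih2

theorem sameContraction_of_face {i : Fin (k + 1)} {P Q : LabelledPair g (k + 1)}
    (h : P.face (Fin.succAboveEmb i) ≈ Q.face (Fin.succAboveEmb i)) :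
    SameContraction P.ends Q.ends i := by
  obtain ⟨φ⟩ := h
  obtain ⟨f, _, F⟩ := exists_isFace (Fin.succAboveEmb i) P
  obtain ⟨f', _, F'⟩ := exists_isFace (Fin.succAboveEmb i) Q
  have m := F.merges
  refine ⟨_, φ.onV ∘ f, f', ⟨φ.onV.surjective.comp m.1, fun u v => ?_⟩, F'.merges, fun j hj => ?_⟩
  · rw [← m.2]
    exact φ.onV.injective.eq_iff
  · obtain ⟨t, rfl⟩ := Fin.exists_succAbove_eq hj
    have h1 := F.ends_eq t
    have h2 := F'.ends_eq t
    rw [← φ.map_ends, h1, Sym2.map_map] at h2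
    exact h2

/-! ### Labelled stable graphs with prescribed ends -/

/-- The graph with vertex set `V` whose edge `i` has the ends `a i false` and `a i true`. -/
def graphOfEnds {V : Type} [Fintype V] (a : Fin k → Bool → V) : HalfEdgeGraph where
  V := V
  H := Fin k × Bool
  r h := a h.1 h.2
  s h := (h.1, !h.2)
  s_s h := by simp
  s_ne h e := by simpa using congrArg Prod.snd e

/-- The edges of `graphOfEnds a` are indexed by `Fin k`. -/
def graphOfEndsEdge {V : Type} [Fintype V] (a : Fin k → Bool → V) :
    (graphOfEnds a).Edge ≃ Fin k where
  toFun := Quotient.lift (s := (graphOfEnds a).edgeSetoid) Prod.fst (by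
    rintro h _ (rfl | rfl) <;> rfl)
  invFun i := (graphOfEnds a).edge (i, false)
  left_inv e := by
    obtain ⟨⟨i, b⟩, rfl⟩ := HalfEdgeGraph.edge_surjective e
    refine HalfEdgeGraph.edge_eq_iff.2 ?_
    cases b
    · exact Or.inl rfl
    · exact Or.inr rfl
  right_inv i := rfl

open Classical in
/-- The labelled stable graph on the vertex set `V` whose edge `i` has the ends `a i false` and
`a i true`. -/
def ofEnds {V : Type} [Fintype V] [Nonempty V] (a : Fin k → Bool → V) (w : V → ℕ)
    (hc : IsJoined fun i => s(a i false, a i true))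
    (hg : (k : ℤ) - Fintype.card V + 1 + ∑ v, (w v : ℤ) = g)
    (hs : ∀ v, 2 < 2 * w v + (Finset.univ.filter fun x : Fin k × Bool => a x.1 x.2 = v).card) :
    LabelledPair g k where
  toHalfEdgeGraph := graphOfEnds a
  w := w
  connected := by
    refine ⟨‹Nonempty V›, fun u v => ?_⟩
    have := hc {v | Relation.ReflTransGen ((graphOfEnds a).Link Set.univ) u v}
      ⟨u, Relation.ReflTransGen.refl⟩ (fun i x y h hx => by
        refine hx.tail ?_
        rcases Sym2.eq_iff.1 h with ⟨h1, h2⟩ | ⟨h1, h2⟩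
        · exact ⟨(i, false), Set.mem_univ _, h1, h2⟩
        · exact ⟨(i, true), Set.mem_univ _, h2, h1⟩)
    exact Set.eq_univ_iff_forall.1 this v
  genus_eq := by
    unfold HalfEdgeGraph.b1
    rw [Fintype.card_congr (graphOfEndsEdge a), Fintype.card_fin]
    exact hg
  stable v := by
    convert hs v using 2
    unfold HalfEdgeGraph.val
    rfl
  τ := graphOfEndsEdge a

theorem ends_ofEnds {V : Type} [Fintype V] [Nonempty V] (a : Fin k → Bool → V) (w : V → ℕ) (hc)
    (hg : (k : ℤ) - Fintype.card V + 1 + ∑ v, (w v : ℤ) = g) (hs) (i : Fin k) :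
    (ofEnds a w hc hg hs).ends i = s(a i false, a i true) :=
  (ofEnds a w hc hg hs).ends_lab (i, false)

end LabelledPair

/-! ### Simplices, facets and symmetries -/

/-- The simplex of `Δ_g` represented by a labelled stable graph. -/
def LabelledPair.toSimplex (P : LabelledPair g k) : Simplices g k := Quotient.mk _ P

namespace Simplices

theorem exists_rep (x : Simplices g k) : ∃ P : LabelledPair g k, P.toSimplex = x :=
  Quotient.exists_rep x

theorem toSimplex_eq_iff {P Q : LabelledPair g k} : P.toSimplex = Q.toSimplex ↔ P ≈ Q :=
  Quotient.eq

theorem numVertices_toSimplex (P : LabelledPair g k) :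
    P.toSimplex.numVertices = Fintype.card P.V := rfl

theorem numVertices_pos (x : Simplices g k) : 0 < x.numVertices := by
  obtain ⟨P, rfl⟩ := x.exists_rep
  exact Fintype.card_pos_iff.2 P.nonempty_V

/-- The facet obtained by contracting the edge labelled `i`. -/
noncomputable def facet (i : Fin (k + 1)) (x : Simplices g (k + 1)) : Simplices g k :=
  x.face (Fin.succAboveEmb i)

theorem numVertices_facet {P : LabelledPair g (k + 1)} {i : Fin (k + 1)}
    (hi : ¬ (P.ends i).IsDiag) :
    (P.toSimplex.facet i).numVertices + 1 = P.toSimplex.numVertices := by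
  obtain ⟨f, j, F⟩ := P.exists_isFace (Fin.succAboveEmb i)
  exact F.merges.card hi

theorem isDiag_ends_iff {P : LabelledPair g (k + 1)} {i : Fin (k + 1)} :
    (P.ends i).IsDiag ↔ (P.toSimplex.facet i).numVertices = P.toSimplex.numVertices := by
  constructor
  · intro hi
    obtain ⟨f, j, F⟩ := P.exists_isFace (Fin.succAboveEmb i)
    exact (Fintype.card_of_bijective (F.merges.bijective hi)).symm
  · intro h
    by_contra hi
    have := numVertices_facet hi
    omega

theorem exists_not_isDiag {P : LabelledPair g k} (h : 1 < Fintype.card P.V) :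
    ∃ i, ¬ (P.ends i).IsDiag := by
  obtain ⟨x, y, hxy⟩ := Fintype.exists_pair_of_one_lt_card h
  obtain ⟨i, w, hw, hi⟩ := P.isJoined_ends.exists_ne_adj hxy
  exact ⟨i, not_isDiag_iff_exists.2 ⟨y, w, hw.symm, hi⟩⟩

theorem toSimplex_eq_of_ends {P Q : LabelledPair g k} (hP : P.IsFull) (φ : P.V ≃ Q.V)
    (h : ∀ i, (P.ends i).map φ = Q.ends i) : P.toSimplex = Q.toSimplex := by
  have hQ : Q.IsFull := by
    unfold LabelledPair.IsFull at hP ⊢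
    rw [hP, Fintype.card_congr φ]
  rw [LabelledPair.isFull_iff] at hP hQ
  exact toSimplex_eq_iff.2 (LabelledPair.nonempty_iso_of_ends φ h fun v => by rw [hP, hQ])

/-- If a permutation of the labels fixes a simplex, then it is induced by an automorphism of the
graph. -/
theorem exists_equiv_of_face_perm_eq {P : LabelledPair g k} {σ : Equiv.Perm (Fin k)}
    (h : P.toSimplex.face σ.toEmbedding = P.toSimplex) :
    ∃ φ : P.V ≃ P.V, ∀ i, (P.ends (σ i)).map φ = P.ends i := by
  obtain ⟨φ⟩ := toSimplex_eq_iff.1 h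
  obtain ⟨f, j, F⟩ := P.exists_isFace σ.toEmbedding
  refine ⟨(Equiv.ofBijective f F.bijective_of_perm).trans φ.onV, fun i => ?_⟩
  have h1 := φ.map_ends i
  rw [F.ends_eq, Sym2.map_map] at h1
  exact h1

theorem face_perm_eq_of_ends {P : LabelledPair g k} (hP : P.IsFull) {σ : Equiv.Perm (Fin k)}
    (φ : P.V ≃ P.V) (h : ∀ i, (P.ends (σ i)).map φ = P.ends i) :
    P.toSimplex.face σ.toEmbedding = P.toSimplex := by
  obtain ⟨f, j, F⟩ := P.exists_isFace σ.toEmbedding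
  symm
  refine toSimplex_eq_of_ends hP (φ.symm.trans (Equiv.ofBijective f F.bijective_of_perm))
    fun i => ?_
  rw [F.ends_eq, ← h i, Sym2.map_map]
  congr 1
  ext v
  simp

/-- There is only one labelled stable graph with one vertex and `k` edges. -/
theorem eq_of_numVertices_eq_one {x y : Simplices g k} (hx : x.numVertices = 1)
    (hy : y.numVertices = 1) : x = y := by
  obtain ⟨P, rfl⟩ := x.exists_rep
  obtain ⟨Q, rfl⟩ := y.exists_rep
  rw [numVertices_toSimplex] at hx hy
  have gP := P.genus_eq_card
  have gQ := Q.genus_eq_card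
  obtain ⟨a, ha⟩ := Fintype.card_eq_one_iff.1 hx
  obtain ⟨b, hb⟩ := Fintype.card_eq_one_iff.1 hy
  have uP : (Finset.univ : Finset P.V) = {a} := by ext v; simp [ha v]
  have uQ : (Finset.univ : Finset Q.V) = {b} := by ext v; simp [hb v]
  rw [hx, uP, Finset.sum_singleton] at gP
  rw [hy, uQ, Finset.sum_singleton] at gQ
  have sP : Subsingleton P.V := ⟨fun u v => (ha u).trans (ha v).symm⟩
  have sQ : Subsingleton Q.V := ⟨fun u v => (hb u).trans (hb v).symm⟩
  refine toSimplex_eq_iff.2 (LabelledPair.nonempty_iso_of_ends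
    ⟨fun _ => b, fun _ => a, fun _ => Subsingleton.elim _ _, fun _ => Subsingleton.elim _ _⟩
    (fun i => ?_) fun v => ?_)
  · exact Subsingleton.elim _ _
  · rw [ha v]
    change Q.w b = P.w a
    omega

/-- The genus formula bounds the number of edges; equality holds for full graphs. -/
theorem add_one_le (x : Simplices g k) : k + 1 ≤ g + x.numVertices := by
  obtain ⟨P, rfl⟩ := x.exists_rep
  rw [numVertices_toSimplex]
  have gP := P.genus_eq_card
  have : (0 : ℤ) ≤ ∑ v, (P.w v : ℤ) := Finset.sum_nonneg fun _ _ => Int.natCast_nonneg _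
  omega

theorem card_le_of_numVertices_eq_one {x : Simplices g k} (hx : x.numVertices = 1) : k ≤ g := by
  have := x.add_one_le
  omega

/-! ### The symmetric simplex with `g + 1` edges -/

/-- A simplex that is invariant under all permutations of its edge labels. -/
def IsSymmetric (x : Simplices g k) : Prop :=
  ∀ σ : Equiv.Perm (Fin k), x.face σ.toEmbedding = x

/-- In a graph with `g + 1` edges that are all interchangeable, at least two vertices have weight
zero by the genus formula, and a vertex of weight zero has valence at least three. Exchanging one
of its edges with an edge away from it would make the other two parallel, so that all edges are
parallel. Hence a vertex of weight zero is incident to all edges. -/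
theorem IsSymmetric.ends_and_card {P : LabelledPair g (g + 1)} (hP : P.toSimplex.IsSymmetric) :
    (∀ i, ¬ (P.ends i).IsDiag) ∧ Fintype.card P.V = 2 := by
  classical
  have hs := fun σ => exists_equiv_of_face_perm_eq (hP σ)
  have hcard : Fintype.card P.V = 2 + ∑ v, P.w v := by
    have := P.genus_eq_card
    zify
    push_cast at this
    linarith
  have hnd : ∀ i, ¬ (P.ends i).IsDiag := by
    intro i hi
    obtain ⟨j, hj⟩ := exists_not_isDiag (P := P) (by omega)
    obtain ⟨φ, h⟩ := hs (Equiv.swap i j)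
    apply hj
    rw [← h j, Equiv.swap_apply_right]
    exact hi.map
  have hzero : 1 < (Finset.univ.filter fun v => P.w v = 0).card := by
    have h1 : ∑ v : P.V, 1 ≤ ∑ v, (P.w v + if P.w v = 0 then 1 else 0) :=
      Finset.sum_le_sum fun v _ => by split_ifs <;> omega
    rw [Finset.sum_add_distrib, ← Finset.card_filter, Finset.sum_const, Finset.card_univ,
      smul_eq_mul, mul_one] at h1
    omega
  have hall : ∀ v, P.w v = 0 → ∀ f, v ∈ P.ends f := by
    intro v hv f
    by_contra hf
    rcases P.isThick_ends hv with ⟨i, hi⟩ | ⟨e₁, e₂, e₃, h12, h13, h23, m1, m2, m3⟩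
    · exact hnd i (by simp [hi])
    have n2 : f ≠ e₂ := by rintro rfl; exact hf m2
    have n3 : f ≠ e₃ := by rintro rfl; exact hf m3
    obtain ⟨φ, h⟩ := hs (Equiv.swap e₁ f)
    have a1 := h f
    have a2 := h e₂
    have a3 := h e₃
    rw [Equiv.swap_apply_right] at a1
    rw [Equiv.swap_apply_of_ne_of_ne h12.symm n2.symm] at a2
    rw [Equiv.swap_apply_of_ne_of_ne h13.symm n3.symm] at a3
    have hφv : v ≠ φ v := by
      intro e
      apply hf
      rw [e, ← a1]
      exact Sym2.mem_map.2 ⟨v, m1, rfl⟩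
    have b2 : P.ends e₂ = s(v, φ v) :=
      (Sym2.mem_and_mem_iff hφv).1 ⟨m2, by rw [← a2]; exact Sym2.mem_map.2 ⟨v, m2, rfl⟩⟩
    have b3 : P.ends e₃ = s(v, φ v) :=
      (Sym2.mem_and_mem_iff hφv).1 ⟨m3, by rw [← a3]; exact Sym2.mem_map.2 ⟨v, m3, rfl⟩⟩
    obtain ⟨ψ, h'⟩ := hs (Equiv.swap e₃ f)
    have c1 := h' f
    have c2 := h' e₂
    rw [Equiv.swap_apply_right, b3, ← b2] at c1
    rw [Equiv.swap_apply_of_ne_of_ne h23 n2.symm] at c2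
    exact hf (by rw [← c1, c2]; exact m2)
  refine ⟨hnd, le_antisymm ?_ (by omega)⟩
  obtain ⟨v, hv, v', hv', hne⟩ := Finset.one_lt_card.1 hzero
  simp only [Finset.mem_filter, Finset.mem_univ, true_and] at hv hv'
  have hsub : (Finset.univ : Finset P.V) ⊆ {v, v'} := by
    intro t _
    rw [Finset.mem_insert, Finset.mem_singleton]
    by_cases ht : t = v
    · exact Or.inl ht
    · obtain ⟨i, w, hw, hi⟩ := P.isJoined_ends.exists_ne_adj (v := t) (Ne.symm ht)
      have h1 : P.ends i = s(v, v') := (Sym2.mem_and_mem_iff hne).1 ⟨hall v hv i, hall v' hv' i⟩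
      have h2 : t ∈ P.ends i := by simp [hi]
      rw [h1, Sym2.mem_iff] at h2
      exact h2
  exact (Finset.card_le_card hsub).trans Finset.card_le_two

theorem IsSymmetric.numVertices_facet {x : Simplices g (g + 1)} (hx : x.IsSymmetric)
    (i : Fin (g + 1)) : (x.facet i).numVertices = 1 := by
  obtain ⟨P, rfl⟩ := x.exists_rep
  obtain ⟨h1, h2⟩ := hx.ends_and_card
  have := Simplices.numVertices_facet (h1 i)
  rw [numVertices_toSimplex, h2] at this
  omega

open LabelledPair in
/-- The graph with two vertices of weight zero and `g + 1` edges between them is symmetric. -/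
theorem exists_isSymmetric (hg : 2 ≤ g) : ∃ x : Simplices g (g + 1), x.IsSymmetric := by
  classical
  let a : Fin (g + 1) → Bool → Bool := fun _ b => b
  have hc : IsJoined fun i => s(a i false, a i true) := by
    rintro S ⟨u, hu⟩ hS
    rw [Set.eq_univ_iff_forall]
    intro v
    rcases Bool.eq_or_eq_not v u with rfl | rfl
    · exact hu
    · refine hS 0 u _ ?_ hu
      cases u
      · rfl
      · exact Sym2.eq_swap
  let P : LabelledPair g (g + 1) := ofEnds a (fun _ => 0) hc (by simp; ring) (fun v => by
    rw [mul_zero, zero_add]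
    refine Finset.two_lt_card.2 ⟨(⟨0, by omega⟩, v), ?_, (⟨1, by omega⟩, v), ?_,
      (⟨2, by omega⟩, v), ?_, ?_⟩
    all_goals simp [a])
  have hP : ∀ i, P.ends i = s(a i false, a i true) := fun i => ends_ofEnds _ _ _ _ _ i
  refine ⟨P.toSimplex, fun σ => face_perm_eq_of_ends ?_ (Equiv.refl _) fun i => ?_⟩
  · rw [isFull_iff]
    exact fun _ => rfl
  · rw [Equiv.coe_refl, Sym2.map_id]
    rw [hP, hP]
    rfl

end Simplices

/-! ### Automorphisms preserve the number of vertices -/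

/-- An automorphism of `Δ_g`: a family of bijections that commutes with the face maps. -/
structure FaceEquiv (g : ℕ) where
  app : ∀ k, Simplices g k ≃ Simplices g k
  map_face : ∀ {k l : ℕ} (ι : Fin k ↪ Fin l) (x : Simplices g l),
    app k (x.face ι) = (app l x).face ι

namespace FaceEquiv

open Simplices

variable (Φ : FaceEquiv g)

/-- The inverse automorphism. -/
def symm : FaceEquiv g where
  app k := (Φ.app k).symm
  map_face ι x := by rw [Equiv.symm_apply_eq, Φ.map_face, Equiv.apply_symm_apply]

theorem map_facet (i : Fin (k + 1)) (x : Simplices g (k + 1)) :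
    Φ.app k (x.facet i) = (Φ.app (k + 1) x).facet i :=
  Φ.map_face _ _

theorem face_perm_eq_iff (x : Simplices g k) (σ : Equiv.Perm (Fin k)) :
    (Φ.app k x).face σ.toEmbedding = Φ.app k x ↔ x.face σ.toEmbedding = x := by
  rw [← Φ.map_face, (Φ.app k).injective.eq_iff]

/-- A graph with one vertex is a face of a symmetric simplex, and so is its image. -/
theorem numVertices_eq_one (hg : 2 ≤ g) {x : Simplices g k} (hx : x.numVertices = 1) :
    (Φ.app k x).numVertices = 1 := by
  obtain ⟨B, hB⟩ := exists_isSymmetric hg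
  have hΦB : (Φ.app _ B).IsSymmetric := fun σ => (Φ.face_perm_eq_iff B σ).2 (hB σ)
  let ι : Fin k ↪ Fin g := Fin.castLEEmb (card_le_of_numVertices_eq_one hx)
  have h1 : ∀ y : Simplices g (g + 1), y.IsSymmetric →
      ((y.facet 0).face ι).numVertices = 1 := fun y hy =>
    le_antisymm ((numVertices_face ι _).trans (hy.numVertices_facet 0).le) (numVertices_pos _)
  rw [eq_of_numVertices_eq_one hx (h1 B hB), Φ.map_face, map_facet]
  exact h1 _ hΦB

theorem numVertices_le (hg : 2 ≤ g) (n : ℕ) : ∀ (Φ : FaceEquiv g) (k : ℕ) (x : Simplices g k),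
    x.numVertices = n → (Φ.app k x).numVertices ≤ n := by
  induction n with
  | zero => intro Φ k x hx; exact absurd hx (numVertices_pos x).ne'
  | succ n ih =>
    intro Φ k x hx
    rcases Nat.eq_zero_or_pos n with rfl | hn
    · exact (Φ.numVertices_eq_one hg hx).le
    obtain ⟨P, rfl⟩ := x.exists_rep
    obtain ⟨i, hi⟩ := exists_not_isDiag (P := P) (by rw [← numVertices_toSimplex]; omega)
    obtain ⟨k, rfl⟩ : ∃ k', k = k' + 1 := ⟨k - 1, by have := i.2; omega⟩
    have h1 := Simplices.numVertices_facet hi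
    have h2 := ih Φ k (P.toSimplex.facet i) (by omega)
    rw [map_facet] at h2
    obtain ⟨Q, hQ⟩ := (Φ.app _ P.toSimplex).exists_rep
    rw [← hQ] at h2 ⊢
    by_cases hd : (Q.ends i).IsDiag
    · rw [isDiag_ends_iff.1 hd] at h2
      omega
    · have := Simplices.numVertices_facet hd
      omega

theorem numVertices_app (hg : 2 ≤ g) (x : Simplices g k) :
    (Φ.app k x).numVertices = x.numVertices := by
  refine le_antisymm (numVertices_le hg _ Φ k x rfl) ?_
  have := numVertices_le hg _ Φ.symm k (Φ.app k x) rfl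
  rwa [show Φ.symm.app k (Φ.app k x) = x from (Φ.app k).symm_apply_apply x] at this

end FaceEquiv

/-! ### Graphs with two vertices -/

section TwoVertices

variable {ι V W : Type}

theorem eq_of_ne_of_card_eq_two [Fintype V] (h : Fintype.card V = 2) {a s t : V} (hs : s ≠ a)
    (ht : t ≠ a) : s = t := by
  by_contra hst
  have := Fintype.two_lt_card_iff.2 ⟨s, t, a, hst, hs, ht⟩
  omega

theorem eq_of_not_isDiag_of_card_eq_two [Fintype V] (h : Fintype.card V = 2) {y z : Sym2 V}
    (hy : ¬ y.IsDiag) (hz : ¬ z.IsDiag) : y = z := by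
  obtain ⟨a, b, hab, rfl⟩ := not_isDiag_iff_exists.1 hy
  obtain ⟨c, d, hcd, rfl⟩ := not_isDiag_iff_exists.1 hz
  by_cases hca : c = a
  · subst hca
    rw [eq_of_ne_of_card_eq_two h hab.symm hcd.symm]
  · have hda : d = a := eq_of_ne_of_card_eq_two h (Ne.symm hcd) (Ne.symm hca)
    rw [Sym2.eq_swap, hda, eq_of_ne_of_card_eq_two h hab.symm hca]

/-- A graph with two vertices is determined by its set of loops and by the relation that two loops
have the same vertex. -/
theorem exists_equiv_of_card_eq_two [Fintype V] [Fintype W] {p : ι → Sym2 V} {q : ι → Sym2 W}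
    (hV : Fintype.card V = 2) (hW : Fintype.card W = 2)
    (hloop : ∀ j, (p j).IsDiag ↔ (q j).IsDiag)
    (hrel : ∀ i j, (p i).IsDiag → (p j).IsDiag → (p i = p j ↔ q i = q j)) :
    ∃ φ : V ≃ W, ∀ j, (p j).map φ = q j := by
  classical
  have hab : ∃ a b, ∀ j x y, p j = s(x, x) → q j = s(y, y) → (x = a ↔ y = b) := by
    by_cases h : ∃ i, (p i).IsDiag
    · obtain ⟨i, hi⟩ := h
      obtain ⟨a, ha⟩ := exists_eq_diag hi
      obtain ⟨b, hb⟩ := exists_eq_diag ((hloop i).1 hi)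
      refine ⟨a, b, fun j x y hx hy => ?_⟩
      have := hrel j i (by simp [hx]) hi
      simpa [hx, hy, ha, hb] using this
    · push Not at h
      have hV' : 0 < Fintype.card V := by omega
      have hW' : 0 < Fintype.card W := by omega
      obtain ⟨a⟩ := Fintype.card_pos_iff.1 hV'
      obtain ⟨b⟩ := Fintype.card_pos_iff.1 hW'
      exact ⟨a, b, fun j x y hx _ => absurd (by simp [hx]) (h j)⟩
  obtain ⟨a, b, hab⟩ := hab
  let e : V ≃ W := Fintype.equivOfCardEq (hV.trans hW.symm)
  let φ : V ≃ W := e.trans (Equiv.swap (e a) b)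
  have φa : φ a = b := by simp [φ]
  refine ⟨φ, fun j => ?_⟩
  by_cases hj : (p j).IsDiag
  · obtain ⟨x, hx⟩ := exists_eq_diag hj
    obtain ⟨y, hy⟩ := exists_eq_diag ((hloop j).1 hj)
    have h := hab j x y hx hy
    rw [hx, hy, Sym2.map_mk]
    by_cases hxa : x = a
    · rw [h.1 hxa, hxa, φa]
    · have h1 : φ x ≠ b := fun h' => hxa (φ.injective (h'.trans φa.symm))
      rw [eq_of_ne_of_card_eq_two hW h1 (mt h.2 hxa)]
  · exact eq_of_not_isDiag_of_card_eq_two hW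
      (by rwa [Sym2.isDiag_map φ.injective]) (mt (hloop j).2 hj)

end TwoVertices

namespace LabelledPair

theorem exists_of_ends {V : Type} [Fintype V] [Nonempty V] (a : Fin k → Bool → V) (w : V → ℕ)
    (hc : IsJoined fun i => s(a i false, a i true))
    (hg : (k : ℤ) - Fintype.card V + 1 + ∑ v, (w v : ℤ) = g)
    (hs : open Classical in
      ∀ v, 2 < 2 * w v + (Finset.univ.filter fun x : Fin k × Bool => a x.1 x.2 = v).card) :
    ∃ (P : LabelledPair g k) (e : V ≃ P.V), (∀ i, P.ends i = s(e (a i false), e (a i true))) ∧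
      ∀ v, P.w (e v) = w v :=
  ⟨ofEnds a w hc hg hs, Equiv.refl _, fun i => ends_ofEnds a w hc hg hs i, fun _ => rfl⟩

/-- An ordering of the ends of the labelled edges. -/
noncomputable def endAt (P : LabelledPair g k) (i : Fin k) (b : Bool) : P.V :=
  if b then P.r (P.s (P.halfEdge i)) else P.r (P.halfEdge i)

theorem ends_eq_endAt (P : LabelledPair g k) (i : Fin k) :
    P.ends i = s(P.endAt i false, P.endAt i true) := by
  simp [endAt, ends]

theorem exists_endAt_eq {P : LabelledPair g k} {i : Fin k} {v : P.V} (h : v ∈ P.ends i) :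
    ∃ b, P.endAt i b = v := by
  rw [ends_eq_endAt, Sym2.mem_iff] at h
  rcases h with h | h
  · exact ⟨_, h.symm⟩
  · exact ⟨_, h.symm⟩

/-- Separating two loops `i` and `j` from their vertex `v`: the edge with the new label `k` joins
`v` to a new vertex, which carries the two loops. The original graph is recovered by contracting
the new edge. -/
theorem exists_split {P : LabelledPair g k} (hP : P.IsFull) {u v : P.V}
    (hcover : ∀ x, x = u ∨ x = v) {i j t₁ t₂ t₃ : Fin k} (hij : i ≠ j)
    (hi : P.ends i = s(v, v)) (hj : P.ends j = s(v, v))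
    (h12 : t₁ ≠ t₂) (h13 : t₁ ≠ t₃) (h23 : t₂ ≠ t₃) (h1 : P.ends t₁ = s(u, v))
    (h2 : P.ends t₂ = s(u, v)) (h3 : P.ends t₃ = s(u, v)) (huv : u ≠ v) :
    ∃ (Z : LabelledPair g (k + 1)) (e : Option P.V ≃ Z.V),
      (∀ t, t ≠ i → t ≠ j → Z.ends t.castSucc = (P.ends t).map (e ∘ some)) ∧
      Z.ends i.castSucc = s(e none, e none) ∧ Z.ends j.castSucc = s(e none, e none) ∧
      Z.ends (Fin.last k) = s(e (some v), e none) ∧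
      Z.toSimplex.facet (Fin.last k) = P.toSimplex := by
  classical
  let a : Fin (k + 1) → Bool → Option P.V :=
    Fin.snoc (α := fun _ => Bool → Option P.V)
      (fun t b => if t = i ∨ t = j then none else some (P.endAt t b))
      (fun b => if b then none else some v)
  have a1 : ∀ t b, t ≠ i → t ≠ j → a t.castSucc b = some (P.endAt t b) := fun t b h h' => by
    simp [a, h, h']
  have a2 : ∀ b, a i.castSucc b = none := fun b => by simp [a]
  have a3 : ∀ b, a j.castSucc b = none := fun b => by simp [a]
  have a4 : a (Fin.last k) false = some v := by simp [a]
  have a5 : a (Fin.last k) true = none := by simp [a]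
  have ne_of : ∀ {t}, P.ends t = s(u, v) → t ≠ i ∧ t ≠ j := by
    intro t ht
    constructor
    · rintro rfl
      rw [hi] at ht
      simp at ht
      exact huv ht.symm
    · rintro rfl
      rw [hj] at ht
      simp at ht
      exact huv ht.symm
  have hc : IsJoined fun t => s(a t false, a t true) := by
    intro S hS hcl
    replace hcl : ∀ t x y, s(a t false, a t true) = s(x, y) → x ∈ S → y ∈ S := hcl
    have hT := P.isJoined_ends (some ⁻¹' S) ?_ fun t x y ht hx => ?_
    · rw [Set.eq_univ_iff_forall] at hT ⊢
      rintro (_ | x)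
      · exact hcl (Fin.last k) _ _ (by rw [a4, a5]) (hT v)
      · exact hT x
    · obtain ⟨_ | x, hx⟩ := hS
      · exact ⟨v, hcl (Fin.last k) _ _ (by rw [a4, a5, Sym2.eq_swap]) hx⟩
      · exact ⟨x, hx⟩
    · by_cases hti : t = i
      · rw [hti, hi] at ht
        have : x = y := by simp at ht; grind
        rwa [← this]
      by_cases htj : t = j
      · rw [htj, hj] at ht
        have : x = y := by simp at ht; grind
        rwa [← this]
      refine hcl t.castSucc _ _ ?_ hx
      rw [a1 t _ hti htj, a1 t _ hti htj, ← Sym2.map_mk, ← ends_eq_endAt, ht, Sym2.map_mk]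
  have hst : ∀ x, x = u ∨ x = v → 2 < (Finset.univ.filter fun y : Fin (k + 1) × Bool =>
      a y.1 y.2 = some x).card := by
    intro x hx
    have key : ∀ t, P.ends t = s(u, v) → ∃ b, a t.castSucc b = some x := by
      intro t ht
      obtain ⟨b, hb⟩ := exists_endAt_eq (P := P) (i := t) (v := x) (by rw [ht]; simpa using hx)
      exact ⟨b, by rw [a1 t b (ne_of ht).1 (ne_of ht).2, hb]⟩
    obtain ⟨b₁, e1⟩ := key t₁ h1
    obtain ⟨b₂, e2⟩ := key t₂ h2
    obtain ⟨b₃, e3⟩ := key t₃ h3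
    refine Finset.two_lt_card.2 ⟨(t₁.castSucc, b₁), by simp [e1], (t₂.castSucc, b₂), by simp [e2],
      (t₃.castSucc, b₃), by simp [e3], ?_, ?_, ?_⟩
    · simp [h12]
    · simp [h13]
    · simp [h23]
  obtain ⟨Z, e, hZ, -⟩ := exists_of_ends (g := g) a (fun _ => 0) hc (by
    unfold IsFull at hP
    rw [Fintype.card_option]
    simp
    omega) (by
    rintro (_ | x)
    · rw [mul_zero, zero_add]
      refine Finset.two_lt_card.2 ⟨(i.castSucc, false), ?_, (i.castSucc, true), ?_,
        (j.castSucc, false), ?_, ?_⟩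
      · simp [a2]
      · simp [a2]
      · simp [a3]
      · simp [hij]
    · rw [mul_zero, zero_add]
      convert hst x (hcover x))
  have z1 : ∀ t, t ≠ i → t ≠ j → Z.ends t.castSucc = (P.ends t).map (e ∘ some) := by
    intro t hti htj
    rw [hZ, a1 t _ hti htj, a1 t _ hti htj, ends_eq_endAt, Sym2.map_mk]
    rfl
  have z2 : Z.ends i.castSucc = s(e none, e none) := by rw [hZ, a2, a2]
  have z3 : Z.ends j.castSucc = s(e none, e none) := by rw [hZ, a3, a3]
  have z4 : Z.ends (Fin.last k) = s(e (some v), e none) := by rw [hZ, a4, a5]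
  refine ⟨Z, e, z1, z2, z3, z4, ?_⟩
  obtain ⟨f, _, F⟩ := Z.exists_isFace (Fin.succAboveEmb (Fin.last k))
  have hm := F.merges
  have fv : f (e (some v)) = f (e none) := (hm.2 _ _).2 (Or.inr z4)
  have hb : Function.Bijective fun x => f (e (some x)) := by
    constructor
    · intro x y hxy
      rcases (hm.2 _ _).1 hxy with h | h
      · simpa using h
      · have : e none ∈ s(e (some x), e (some y)) := h ▸ z4 ▸ Sym2.mem_mk_right _ _
        simp at this
    · intro c
      obtain ⟨z, rfl⟩ := hm.1 c
      obtain ⟨_ | x, rfl⟩ := e.surjective z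
      · exact ⟨v, fv⟩
      · exact ⟨x, rfl⟩
  symm
  refine Simplices.toSimplex_eq_of_ends hP (Equiv.ofBijective _ hb) fun t => ?_
  rw [F.ends_eq, Fin.coe_succAboveEmb, Fin.succAbove_last]
  by_cases hti : t = i
  · rw [hti, hi, z2, Sym2.map_mk, Sym2.map_mk, ← fv]; rfl
  by_cases htj : t = j
  · rw [htj, hj, z3, Sym2.map_mk, Sym2.map_mk, ← fv]; rfl
  rw [z1 t hti htj, Sym2.map_map]
  rfl

end LabelledPair

namespace Simplices

/-- If there is a third loop, two loops of a full graph with two vertices have the same vertex if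
and only if exchanging their labels does not change the simplex. -/
theorem face_swap_eq_iff {P : LabelledPair g k} (hP : P.IsFull)
    (hV : Fintype.card P.V = 2) {i j t : Fin k} (hi : (P.ends i).IsDiag) (hj : (P.ends j).IsDiag)
    (ht : (P.ends t).IsDiag) (hti : t ≠ i) (htj : t ≠ j) :
    P.toSimplex.face (Equiv.swap i j).toEmbedding = P.toSimplex ↔ P.ends i = P.ends j := by
  constructor
  · intro h
    obtain ⟨φ, hφ⟩ := exists_equiv_of_face_perm_eq h
    have e1 := hφ i
    have e2 := hφ t
    rw [Equiv.swap_apply_left] at e1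
    rw [Equiv.swap_apply_of_ne_of_ne hti htj] at e2
    obtain ⟨a, ha⟩ := exists_eq_diag hi
    obtain ⟨b, hb⟩ := exists_eq_diag hj
    obtain ⟨c, hc⟩ := exists_eq_diag ht
    rw [ha, hb, Sym2.map_mk, Sym2.eq_iff, or_self, and_self] at e1
    rw [hc, Sym2.map_mk, Sym2.eq_iff, or_self, and_self] at e2
    rw [ha, hb]
    by_contra hne
    have hab : a ≠ b := fun h => hne (by rw [h])
    by_cases hca : c = a
    · exact hab (φ.injective (by rw [← hca, e2, hca, e1]))
    · have : c = b := eq_of_ne_of_card_eq_two hV hca hab.symm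
      exact hab (by rw [← e1, ← this, e2])
  · intro h
    refine face_perm_eq_of_ends hP (Equiv.refl _) fun s => ?_
    rw [Equiv.coe_refl, Sym2.map_id]
    change P.ends (Equiv.swap i j s) = P.ends s
    by_cases hsi : s = i
    · rw [hsi, Equiv.swap_apply_left, h]
    by_cases hsj : s = j
    · rw [hsj, Equiv.swap_apply_right, h]
    rw [Equiv.swap_apply_of_ne_of_ne hsi hsj]

end Simplices

namespace FaceEquiv

open Simplices

variable (Φ : FaceEquiv g)

theorem isDiag_ends_iff (hg : 2 ≤ g) {P Q : LabelledPair g k}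
    (hQ : Q.toSimplex = Φ.app k P.toSimplex) (i : Fin k) :
    (P.ends i).IsDiag ↔ (Q.ends i).IsDiag := by
  obtain ⟨k, rfl⟩ : ∃ k', k = k' + 1 := ⟨k - 1, by have := i.2; omega⟩
  rw [Simplices.isDiag_ends_iff, Simplices.isDiag_ends_iff, hQ, ← map_facet,
    Φ.numVertices_app hg, Φ.numVertices_app hg]

theorem card_eq (hg : 2 ≤ g) {P Q : LabelledPair g k} (hQ : Q.toSimplex = Φ.app k P.toSimplex) :
    Fintype.card Q.V = Fintype.card P.V := by
  rw [← numVertices_toSimplex, hQ, Φ.numVertices_app hg, numVertices_toSimplex]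

/-- A full graph with two vertices and at least three loops is fixed. -/
theorem app_eq_of_three_loops (hg : 2 ≤ g) {P : LabelledPair g k} (hP : P.IsFull)
    (hV : Fintype.card P.V = 2) (h3 : ∀ i j, ∃ t, t ≠ i ∧ t ≠ j ∧ (P.ends t).IsDiag) :
    Φ.app k P.toSimplex = P.toSimplex := by
  obtain ⟨Q, hQ⟩ := (Φ.app k P.toSimplex).exists_rep
  have hloop := Φ.isDiag_ends_iff hg hQ
  have hcard := Φ.card_eq hg hQ
  have hW := hcard.trans hV
  have hQf : Q.IsFull := by unfold LabelledPair.IsFull at hP ⊢; rwa [hcard]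
  obtain ⟨φ, hφ⟩ := exists_equiv_of_card_eq_two hV hW hloop (fun i j hi hj => by
    obtain ⟨t, hti, htj, ht⟩ := h3 i j
    rw [← face_swap_eq_iff hP hV hi hj ht hti htj, ← face_swap_eq_iff hQf hW ((hloop i).1 hi)
      ((hloop j).1 hj) ((hloop t).1 ht) hti htj, hQ, face_perm_eq_iff])
  rw [← hQ, toSimplex_eq_of_ends hP φ hφ]

/-- With only two loops, exchanging their labels never changes the simplex. If the two loops are at
the same vertex, they are moved to a new vertex at the end of a new edge. Contracting one of the
parallel edges of that graph makes loops of the other parallel edges, away from the two given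
loops, and the result is fixed since it has at least three loops. This forces the two loops to have
the same vertex in the image as well. -/
theorem ends_eq_of_two_loops (hg : 2 ≤ g) {P Q : LabelledPair g k} (hP : P.IsFull)
    (hV : Fintype.card P.V = 2) (hQ : Q.toSimplex = Φ.app k P.toSimplex) {i j : Fin k}
    (hij : i ≠ j) (hi : (P.ends i).IsDiag) (hloops : ∀ t, (P.ends t).IsDiag → t = i ∨ t = j)
    (he : P.ends i = P.ends j) : Q.ends i = Q.ends j := by
  classical
  obtain ⟨v, hv⟩ := exists_eq_diag hi
  have hv' := he ▸ hv
  obtain ⟨u, huv⟩ := Fintype.exists_ne_of_one_lt_card (by omega : 1 < Fintype.card P.V) v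
  have hcover : ∀ x, x = u ∨ x = v := fun x => by
    by_cases hx : x = v
    · exact Or.inr hx
    · exact Or.inl (eq_of_ne_of_card_eq_two hV hx huv)
  have hthick := P.isThick_ends ((P.isFull_iff.1 hP) u)
  -- the other vertex `u` carries no loop, so it has three edges to `v`
  obtain ⟨t₁, t₂, t₃, h12, h13, h23, m1, m2, m3⟩ := hthick.resolve_left (by
    rintro ⟨t, ht⟩
    rcases hloops t (by simp [ht]) with rfl | rfl
    · rw [ht] at hv; simp at hv; exact huv hv
    · rw [ht] at hv'; simp at hv'; exact huv hv')
  have key : ∀ t, u ∈ P.ends t → P.ends t = s(u, v) := by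
    intro t ht
    refine eq_of_not_isDiag_of_card_eq_two hV (fun hd => ?_) (by simpa using huv)
    rcases hloops t hd with rfl | rfl
    · rw [hv] at ht; simp at ht; exact huv ht
    · rw [hv'] at ht; simp at ht; exact huv ht
  obtain ⟨Z, e, z1, z2, z3, z4, hZP⟩ := LabelledPair.exists_split hP hcover hij hv hv' h12 h13 h23
    (key _ m1) (key _ m2) (key _ m3) huv
  have ne_of : ∀ t, u ∈ P.ends t → t ≠ i ∧ t ≠ j := by
    intro t ht
    constructor
    · rintro rfl; rw [hv] at ht; simp at ht; exact huv ht
    · rintro rfl; rw [hv'] at ht; simp at ht; exact huv ht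
  have zt : ∀ t, u ∈ P.ends t → Z.ends t.castSucc = s(e (some u), e (some v)) := by
    intro t ht
    rw [z1 t (ne_of t ht).1 (ne_of t ht).2, key t ht, Sym2.map_mk]
    rfl
  have hnd : ∀ t, u ∈ P.ends t → ¬ (Z.ends t.castSucc).IsDiag := by
    intro t ht
    rw [zt t ht]
    simpa using huv
  have hZcard : Fintype.card Z.V = 3 := by
    rw [← Fintype.card_congr e, Fintype.card_option, hV]
  obtain ⟨k, rfl⟩ : ∃ k', k = k' + 1 := ⟨k - 1, by have := i.2; omega⟩
  -- `i`, `t₂` and `t₃` are loops after the contraction of `t₁`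
  have hRfix : Φ.app _ (Z.toSimplex.facet t₁.castSucc) = Z.toSimplex.facet t₁.castSucc := by
    obtain ⟨f, _, F⟩ := Z.exists_isFace (Fin.succAboveEmb t₁.castSucc)
    have hm := F.merges
    have hcard := hm.card (hnd t₁ m1)
    refine Φ.app_eq_of_three_loops hg (P := Z.face (Fin.succAboveEmb t₁.castSucc)) ?_ ?_ ?_
    · unfold LabelledPair.IsFull at hP ⊢
      omega
    · omega
    · intro a b
      have hex : ∀ t : Fin (k + 1), t ≠ t₁ → ((Z.ends t.castSucc).map f).IsDiag →
          ∃ r : Fin (k + 1), t₁.castSucc.succAbove r = t.castSucc ∧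
            ((Z.face (Fin.succAboveEmb t₁.castSucc)).ends r).IsDiag := by
        intro t ht hd
        obtain ⟨r, hr⟩ := Fin.exists_succAbove_eq
          (fun h => ht (Fin.castSucc_injective _ h) : t.castSucc ≠ t₁.castSucc)
        refine ⟨r, hr, ?_⟩
        rw [F.ends_eq, Fin.coe_succAboveEmb, hr]
        exact hd
      obtain ⟨r₁, e1, d1⟩ := hex i (ne_of t₁ m1).1.symm (by rw [z2]; simp)
      obtain ⟨r₂, e2, d2⟩ := hex t₂ h12.symm
        ((hm.map_isDiag_iff _).2 (Or.inr (by rw [zt _ m1, zt _ m2])))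
      obtain ⟨r₃, e3, d3⟩ := hex t₃ h13.symm
        ((hm.map_isDiag_iff _).2 (Or.inr (by rw [zt _ m1, zt _ m3])))
      have n12 : r₁ ≠ r₂ := by
        rintro rfl
        exact (ne_of t₂ m2).1 (Fin.castSucc_injective _ (e2.symm.trans e1))
      have n13 : r₁ ≠ r₃ := by
        rintro rfl
        exact (ne_of t₃ m3).1 (Fin.castSucc_injective _ (e3.symm.trans e1))
      have n23 : r₂ ≠ r₃ := by
        rintro rfl
        exact h23 (Fin.castSucc_injective _ (e2.symm.trans e3))
      exact exists_ne_ne_of_three n12 n13 n23 d1 d2 d3 a b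
  -- `Y` is the image of `Z`; it contracts to `Q` along the new edge and to `Z / t₁` along `t₁`
  obtain ⟨Y, hY⟩ := (Φ.app _ Z.toSimplex).exists_rep
  have hYP : Y.toSimplex.facet (Fin.last _) = Q.toSimplex := by
    rw [hY, ← map_facet, hZP, hQ]
  have hYR : Z.toSimplex.facet t₁.castSucc = Y.toSimplex.facet t₁.castSucc := by
    rw [hY, ← map_facet, hRfix]
  obtain ⟨M, c, c', hc, hc', hcc⟩ :=
    LabelledPair.sameContraction_of_face (toSimplex_eq_iff.1 hYR)
  have hloop := Φ.isDiag_ends_iff hg hY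
  obtain ⟨I, hI⟩ := exists_eq_diag ((hloop i.castSucc).1 (by rw [z2]; simp))
  obtain ⟨J, hJ⟩ := exists_eq_diag ((hloop j.castSucc).1 (by rw [z3]; simp))
  by_contra hne
  have hIJ : I ≠ J := by
    rintro rfl
    apply hne
    obtain ⟨ψ⟩ := toSimplex_eq_iff.1 hYP
    obtain ⟨d, _, D⟩ := Y.exists_isFace (Fin.succAboveEmb (Fin.last _))
    rw [← ψ.map_ends, ← ψ.map_ends, D.ends_eq, D.ends_eq, Fin.coe_succAboveEmb,
      Fin.succAbove_last, hI, hJ]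
  have cI : c (e none) = c' I := by
    have := hcc i.castSucc (fun h => (ne_of t₁ m1).1 (Fin.castSucc_injective _ h).symm)
    simpa [z2, hI] using this
  have cJ : c (e none) = c' J := by
    have := hcc j.castSucc (fun h => (ne_of t₁ m1).2 (Fin.castSucc_injective _ h).symm)
    simpa [z3, hJ] using this
  -- the vertices `I` and `J` of the two loops are identified by the contraction of `t₁`, so `t₁`
  -- joins them, and `t₂` is parallel to `t₁`
  have hY1 : Y.ends t₁.castSucc = s(I, J) :=
    ((hc'.2 _ _).1 (cI.symm.trans cJ)).resolve_left hIJ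
  have h2 := hcc t₂.castSucc (fun h => h12 (Fin.castSucc_injective _ h).symm)
  have hcuv : c (e (some u)) = c (e (some v)) := (hc.2 _ _).2 (Or.inr (zt _ m1))
  rw [zt _ m2, Sym2.map_mk, ← hcuv] at h2
  have hY2 : Y.ends t₂.castSucc = s(I, J) := by
    rw [← hY1]
    exact ((hc'.map_isDiag_iff _).1 (by rw [← h2]; simp)).resolve_left
      (mt (hloop _).2 (hnd _ m2))
  rw [hY2, Sym2.map_mk, ← cI, ← cJ] at h2
  -- hence the loops have the vertex of the loop `t₂` in `Z / t₁`, contrary to the choice of `Z`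
  have hcun : c (e (some u)) = c (e none) := by simpa using h2
  rcases (hc.2 _ _).1 hcun with h | h
  · simp at h
  · rw [zt _ m1] at h
    simp at h

theorem app_eq_of_card_eq_two (hg : 2 ≤ g) {P : LabelledPair g k} (hP : P.IsFull)
    (hV : Fintype.card P.V = 2) : Φ.app k P.toSimplex = P.toSimplex := by
  by_cases h3 : ∀ i j, ∃ t, t ≠ i ∧ t ≠ j ∧ (P.ends t).IsDiag
  · exact Φ.app_eq_of_three_loops hg hP hV h3
  push Not at h3
  obtain ⟨i, j, hij⟩ := h3
  obtain ⟨Q, hQ⟩ := (Φ.app k P.toSimplex).exists_rep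
  have hloop := Φ.isDiag_ends_iff hg hQ
  have hcard := Φ.card_eq hg hQ
  have hW := hcard.trans hV
  have hQf : Q.IsFull := by unfold LabelledPair.IsFull at hP ⊢; rwa [hcard]
  have hPQ : P.toSimplex = Φ.symm.app k Q.toSimplex := by
    rw [hQ]; exact ((Φ.app k).symm_apply_apply _).symm
  have hl : ∀ t, (P.ends t).IsDiag → t = i ∨ t = j := by
    intro t ht
    by_contra! h
    exact hij t h.1 h.2 ht
  obtain ⟨φ, hφ⟩ := exists_equiv_of_card_eq_two hV hW hloop (fun s t hs ht => by
    by_cases hst : s = t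
    · rw [hst]; simp
    have hl' : ∀ r, (P.ends r).IsDiag → r = s ∨ r = t := by
      intro r hr
      have := hl r hr
      have := hl s hs
      have := hl t ht
      grind
    exact ⟨Φ.ends_eq_of_two_loops hg hP hV hQ hst hs hl',
      Φ.symm.ends_eq_of_two_loops hg hQf hW hPQ hst ((hloop s).1 hs)
        fun r hr => hl' r ((hloop r).2 hr)⟩)
  rw [← hQ, toSimplex_eq_of_ends hP φ hφ]

/-! ### Triviality of automorphisms -/

/-- Induction on the number of vertices: contracting an edge that is not a loop keeps a graph full
and removes one vertex, so the contraction is fixed, and the graph is reconstructed from its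
contractions. -/
theorem app_eq_of_isFull (hg : 2 ≤ g) (n : ℕ) : ∀ (k : ℕ) (P : LabelledPair g k), P.IsFull →
    Fintype.card P.V = n → Φ.app k P.toSimplex = P.toSimplex := by
  induction n with
  | zero => intro k P hP hV; exact absurd hV (numVertices_pos P.toSimplex).ne'
  | succ n ih =>
    intro k P hP hV
    rcases Nat.lt_or_ge n 2 with hn | hn
    · interval_cases n
      · exact eq_of_numVertices_eq_one (Φ.numVertices_eq_one hg hV) hV
      · exact Φ.app_eq_of_card_eq_two hg hP hV
    obtain ⟨Q, hQ⟩ := (Φ.app k P.toSimplex).exists_rep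
    have hloop := Φ.isDiag_ends_iff hg hQ
    have hcard := Φ.card_eq hg hQ
    obtain ⟨i, -⟩ := exists_not_isDiag (P := P) (by omega)
    obtain ⟨k, rfl⟩ : ∃ k', k = k' + 1 := ⟨k - 1, by have := i.2; omega⟩
    have hcon : ∀ i, ¬ (P.ends i).IsDiag → SameContraction P.ends Q.ends i := by
      intro i hi
      have h1 := Simplices.numVertices_facet hi
      have h2 : Φ.app k (P.toSimplex.facet i) = P.toSimplex.facet i := by
        refine ih k (P.face (Fin.succAboveEmb i)) ?_ ?_
        · unfold LabelledPair.IsFull at hP ⊢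
          rw [numVertices_toSimplex] at h1
          change Fintype.card (P.face (Fin.succAboveEmb i)).V + 1 = _ at h1
          omega
        · rw [numVertices_toSimplex] at h1
          change Fintype.card (P.face (Fin.succAboveEmb i)).V + 1 = _ at h1
          omega
      refine LabelledPair.sameContraction_of_face (toSimplex_eq_iff.1 ?_)
      change P.toSimplex.facet i = Q.toSimplex.facet i
      rw [hQ, ← map_facet, h2]
    have hthick : ∀ v, IsThick P.ends v := fun v => P.isThick_ends (P.isFull_iff.1 hP v)
    obtain ⟨φ, hφ⟩ : ∃ φ : P.V ≃ Q.V, ∀ j, (P.ends j).map φ = Q.ends j := by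
      rcases hn.lt_or_eq with hn | rfl
      · exact exists_equiv_of_four_le P.isJoined_ends hthick (by omega) hloop hcon
      · exact exists_equiv_of_card_eq_three P.isJoined_ends hthick hV (hcard.trans hV) hloop hcon
    rw [← hQ, toSimplex_eq_of_ends hP φ hφ]

end FaceEquiv

/-! ### Replacing weights by loops -/

namespace LabelledPair

/-- Contracting a loop raises the weight of its vertex by one and changes no other weight. -/
theorem IsFace.weight_of_loop {i : Fin (k + 1)} {P : LabelledPair g (k + 1)} {Q : LabelledPair g k}
    {f : P.V → Q.V} {j : Q.H → P.H} (F : IsFace (Fin.succAboveEmb i) P Q f j) {v : P.V}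
    (hv : P.ends i = s(v, v)) (x : P.V) [Decidable (x = v)] :
    Q.w (f x) = P.w x + if x = v then 1 else 0 := by
  classical
  have hinj := (F.merges.bijective (by simp [hv])).1
  have h := F.weight (f x)
  have h1 : (Finset.univ.filter fun y => f y = f x) = {x} := by
    ext y
    simp [hinj.eq_iff]
  have h2 : (Finset.univ.filter fun t : Fin (k + 1) => t ∉ Set.range (Fin.succAboveEmb i) ∧
      ∃ h, P.lab h = t ∧ f (P.r h) = f x) = if x = v then {i} else ∅ := by
    ext t
    have h3 : (∃ h, P.lab h = i ∧ P.r h = x) ↔ x = v := by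
      constructor
      · rintro ⟨h, rfl, rfl⟩
        rw [ends_lab] at hv
        simp only [Sym2.eq_iff, or_self] at hv
        exact hv.1
      · rintro rfl
        obtain ⟨y, h1, h2, -⟩ := P.exists_halfEdge hv
        exact ⟨y, h1, h2⟩
    have h4 : t ∉ Set.range (Fin.succAboveEmb i) ↔ t = i := by
      simp [Fin.range_succAbove]
    rw [Finset.mem_filter, h4]
    simp only [Finset.mem_univ, true_and, hinj.eq_iff]
    constructor
    · rintro ⟨ht, h'⟩
      rw [if_pos (h3.1 (ht ▸ h')), ht]
      exact Finset.mem_singleton_self _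
    · intro h
      split_ifs at h with hx
      · rw [Finset.mem_singleton] at h
        exact ⟨h, h ▸ h3.2 hx⟩
      · exact absurd h (Finset.notMem_empty _)
  rw [h1, h2, Finset.sum_singleton, Finset.card_singleton] at h
  split_ifs at h ⊢ with hx
  · simp at h; exact_mod_cast h
  · simp at h; exact_mod_cast h

open Classical in
theorem val_le_card_endAt (P : LabelledPair g k) (v : P.V) :
    P.val v ≤ (Finset.univ.filter fun x : Fin k × Bool => P.endAt x.1 x.2 = v).card := by
  unfold HalfEdgeGraph.val
  refine Finset.card_le_card_of_injOn (fun h => (P.lab h, decide (h ≠ P.halfEdge (P.lab h)))) ?_ ?_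
  · intro h hh
    simp only [Finset.coe_filter, Finset.mem_univ, true_and, Set.mem_ofPred_eq] at hh ⊢
    rw [← hh]
    rcases lab_eq_iff.1 (P.lab_halfEdge (P.lab h)) with e | e
    · simp [endAt, ← e]
    · have : h ≠ P.halfEdge (P.lab h) := fun e' => P.s_ne _ (e.symm.trans e')
      simp [endAt, this, ← e]
  · intro h _ h' _ e
    simp only [Prod.mk.injEq, decide_eq_decide] at e
    obtain ⟨e1, e2⟩ := e
    rcases lab_eq_iff.1 e1 with e | e
    · exact e.symm
    · rw [← e1] at e2
      rcases lab_eq_iff.1 (P.lab_halfEdge (P.lab h)) with e3 | e3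
      · exact absurd (not_not.1 (mt e2.2 (not_not.2 e3))) fun e4 => P.s_ne h (by rw [← e, e4, ← e3])
      · have h5 : h ≠ P.halfEdge (P.lab h) := fun e' => P.s_ne _ (e3.symm.trans e')
        refine absurd ?_ (e2.1 h5)
        rw [e]
        nth_rewrite 1 [e3]
        rw [P.s_s]

/-- A unit of weight can be traded for a loop: the graph is the contraction of a graph with one
more loop and the same number of vertices, hence of smaller total weight. -/
theorem exists_loop {P : LabelledPair g k} {v : P.V} (hv : P.w v ≠ 0) :
    ∃ P' : LabelledPair g (k + 1), P'.toSimplex.facet (Fin.last k) = P.toSimplex ∧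
      Fintype.card P'.V = Fintype.card P.V := by
  classical
  let a : Fin (k + 1) → Bool → P.V :=
    Fin.snoc (α := fun _ => Bool → P.V) (fun t b => P.endAt t b) (fun _ => v)
  have a1 : ∀ t b, a t.castSucc b = P.endAt t b := fun t b => by simp [a]
  have a2 : ∀ b, a (Fin.last k) b = v := fun b => by simp [a]
  -- nothing is truncated because `P.w v ≠ 0`
  let w : P.V → ℕ := fun x => P.w x - if x = v then 1 else 0
  have hw : ∀ x, P.w x = w x + if x = v then 1 else 0 := by
    intro x
    simp only [w]
    split_ifs with hx
    · subst hx; omega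
    · rfl
  have hc : IsJoined fun t => s(a t false, a t true) := by
    intro S hS hcl
    refine P.isJoined_ends S hS fun t x y ht hx => hcl t.castSucc x y ?_ hx
    simp only [a1]
    rw [← ends_eq_endAt, ht]
  have : Nonempty P.V := ⟨v⟩
  obtain ⟨P', e, hP', hPw⟩ := exists_of_ends (g := g) a w hc (by
    have h := P.genus_eq_card
    simp only [hw] at h
    push_cast at h ⊢
    rw [Finset.sum_add_distrib] at h
    simp at h
    linarith) (by
    intro x
    have h1 := P.stable x
    have h2 := P.val_le_card_endAt x
    have h3 : (Finset.univ.filter fun y : Fin (k + 1) × Bool => a y.1 y.2 = x).card =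
        (Finset.univ.filter fun y : Fin k × Bool => P.endAt y.1 y.2 = x).card +
          if x = v then 2 else 0 := by
      rw [Finset.card_filter, Finset.card_filter, Fintype.sum_prod_type, Fintype.sum_prod_type,
        Fin.sum_univ_castSucc]
      simp only [a1, a2, eq_comm (a := v)]
      split_ifs <;> simp
    rw [hw] at h1
    have h4 : 2 < 2 * w x +
        (Finset.univ.filter fun y : Fin (k + 1) × Bool => a y.1 y.2 = x).card := by
      rw [h3]
      have h5 : P.val x ≤
          (Finset.univ.filter fun y : Fin k × Bool => P.endAt y.1 y.2 = x).card := by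
        convert h2
      split_ifs at h1 ⊢ <;> omega
    convert h4)
  refine ⟨P', ?_, (Fintype.card_congr e).symm⟩
  have hl : P'.ends (Fin.last k) = s(e v, e v) := by rw [hP', a2, a2]
  obtain ⟨f, _, F⟩ := P'.exists_isFace (Fin.succAboveEmb (Fin.last k))
  have hb : Function.Bijective f := F.merges.bijective (by simp [hl])
  symm
  refine Simplices.toSimplex_eq_iff.2 (nonempty_iso_of_ends
    (e.trans (Equiv.ofBijective f hb)) (fun t => ?_) fun x => ?_)
  · rw [F.ends_eq, Fin.coe_succAboveEmb, Fin.succAbove_last, hP' t.castSucc, a1, a1, ends_eq_endAt]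
    rfl
  · have := F.weight_of_loop hl (e x)
    rw [hPw] at this
    rw [hw x]
    simpa using this

end LabelledPair

namespace FaceEquiv

open Simplices

variable (Φ : FaceEquiv g)

/-- Induction on `d`, the total weight of the graph. -/
theorem app_eq_of_add_eq (hg : 2 ≤ g) (d : ℕ) : ∀ (k : ℕ) (x : Simplices g k),
    k + 1 + d = g + x.numVertices → Φ.app k x = x := by
  induction d with
  | zero =>
    intro k x hx
    obtain ⟨P, rfl⟩ := x.exists_rep
    exact Φ.app_eq_of_isFull hg _ k P hx rfl
  | succ d ih =>
    intro k x hx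
    obtain ⟨P, rfl⟩ := x.exists_rep
    obtain ⟨v, hv⟩ : ∃ v, P.w v ≠ 0 := by
      by_contra! h
      have h1 := P.isFull_iff.2 h
      unfold LabelledPair.IsFull at h1
      rw [numVertices_toSimplex] at hx
      omega
    obtain ⟨P', h1, h2⟩ := LabelledPair.exists_loop hv
    have h3 := ih (k + 1) P'.toSimplex (by
      rw [numVertices_toSimplex, h2, ← numVertices_toSimplex]
      omega)
    rw [← h1, map_facet, h3]

theorem app_eq (hg : 2 ≤ g) (x : Simplices g k) : Φ.app k x = x :=
  Φ.app_eq_of_add_eq hg (g + x.numVertices - (k + 1)) k x (by have := x.add_one_le; omega)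

/-- The family of bijections given by a natural automorphism of the functor `Delta g`. -/
noncomputable def ofAut (Ψ : Aut (Delta g)) : FaceEquiv g where
  app k := (Ψ.app (Opposite.op ⟨k⟩)).toEquiv
  map_face {k l} ι x := by
    let f : (SymmIndex.mk k) ⟶ (SymmIndex.mk l) := ι
    exact (ConcreteCategory.congr_hom (Ψ.hom.naturality f.op) x)

end FaceEquiv

theorem aut_eq_one (hg : 2 ≤ g) (Ψ : Aut (Delta g)) : Ψ = 1 := by
  apply Iso.ext
  ext a x
  exact (FaceEquiv.ofAut Ψ).app_eq hg x

end TropicalModuli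

theorem mainTheorem6 (g : ℕ) (hg : 2 ≤ g) :
    (∀ Φ : CategoryTheory.Aut (TropicalModuli.Delta g),
      CategoryTheory.CategoryStruct.comp (TropicalModuli.vertexSubcomplex g 2).ι Φ.hom =
        (TropicalModuli.vertexSubcomplex g 2).ι) ∧
    (∀ Φ : CategoryTheory.Aut (TropicalModuli.Delta g), Φ = 1) := by
  refine ⟨fun Φ => ?_, TropicalModuli.aut_eq_one hg⟩
  rw [TropicalModuli.aut_eq_one hg Φ]
  exact CategoryTheory.Category.comp_id _
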